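/- Let $n\in\mathbb N$, let $M_n$ be the space of complex $n\times n$ matrices, and let $q\in L_{1,\mathrm{loc}}([0,\infty);M_n)$. There is a continuous matrix-valued function $w(x,t)$, defined for $0\le x\le t<\infty$ and unique there, such that $v(\xi,\eta):=w\big(\tfrac{\eta-\xi}2,\tfrac{\eta+\xi}2\big)$ satisfies, for all $0\le\xi\le\eta$, the integral equation $$v(\xi,\eta)=-\frac12\int_{\xi/2}^{\eta/2}q(s)\,ds-\frac14\int_0^{\xi}d\xi_1\int_{\xi}^{\eta}d\eta_1\,q\Big(\frac{\eta_1-\xi_1}{2}\Big)v(\xi_1,\eta_1)$$ (the integral form of the Goursat problem $w_{tt}-w_{xx}+qw=0$, $w(0,t)=0$, $w(x,x)=-\frac12\int_0^xq(s)\,ds$). For this $w$ and for every $f\in C^\infty([0,\infty);\mathbb C^n)$ with $\operatorname{supp}f\subset(0,\infty)$, continued by zero to the negative half-line, the function $$u(x,t)=f(t-x)+\int_x^tw(x,s)f(t-s)\,ds,\qquad x\ge0,\ t\ge0,$$ has the following properties. 1. For every $t>0$ and a.e. $x\in(0,t)$, the second partial derivatives $u_{tt}(x,t)$ and $u_{xx}(x,t)$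 exist and $u_{tt}(x,t)-u_{xx}(x,t)+q(x)u(x,t)=0$. 2. $u(x,t)=0$ whenever $x\ge t\ge0$. 3. $u(0,t)=f(t)$ for all $t\ge0$. 4. For every $t\ge0$, $u(\cdot,t)\in W^2_1([0,t];\mathbb C^n)$ (that is, $u(\cdot,t)$ and its first and second weak derivatives on $(0,t)$ are summable), the second weak derivative coincides a.e. on $(0,t)$ with the pointwise derivative $u_{xx}(\cdot,t)$, and $-u_{xx}(\cdot,t)+q(\cdot)u(\cdot,t)\in C([0,t];\mathbb C^n)$, i.e. it coincides a.e. on $(0,t)$ with a function continuous on $[0,t]$. -/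

import Mathlib

open Set MeasureTheory Filter Topology
open scoped ContDiff Matrix Matrix.Norms.L2Operator

/-- The function `v(ξ,η) = w(x,t)`: the kernel `w` in the characteristic variables `ξ = t - x`, `η = t + x`. -/
noncomputable def charVars {n : ℕ} (w : ℝ → ℝ → Matrix (Fin n) (Fin n) ℂ) (ξ η : ℝ) :
    Matrix (Fin n) (Fin n) ℂ :=
  w ((η - ξ) / 2) ((η + ξ) / 2)

/-- `w` is a continuous solution, on `0 ≤ x ≤ t < ∞`, of the integral equation of the Goursat
problem `w_tt - w_xx + q w = 0`, `w(0,t) = 0`, `w(x,x) = -(1/2) ∫₀ˣ q`. Values of `w` outside the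
region `0 ≤ x ≤ t` play no role. -/
structure IsGoursatKernel {n : ℕ} (q : ℝ → Matrix (Fin n) (Fin n) ℂ)
    (w : ℝ → ℝ → Matrix (Fin n) (Fin n) ℂ) : Prop where
  continuousOn : ContinuousOn (fun p : ℝ × ℝ => w p.1 p.2) {p : ℝ × ℝ | 0 ≤ p.1 ∧ p.1 ≤ p.2}
  integral_eq : ∀ ξ η : ℝ, 0 ≤ ξ → ξ ≤ η →
    charVars w ξ η =
      -((1 / 2 : ℝ) • ∫ s in (ξ / 2)..(η / 2), q s)
        - (1 / 4 : ℝ) • ∫ ξ₁ in (0 : ℝ)..ξ, ∫ η₁ in ξ..η,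
            q ((η₁ - ξ₁) / 2) * charVars w ξ₁ η₁

/-- Continuation of a function on `[0,∞)` by zero to the negative half-line. -/
noncomputable def zeroExt {n : ℕ} (f : ℝ → Fin n → ℂ) : ℝ → Fin n → ℂ :=
  (Ici (0 : ℝ)).indicator f

/-- `u(x,t) = f(t - x) + ∫_x^t w(x,s) f(t - s) ds`, with `f` continued by zero. -/
noncomputable def wave {n : ℕ} (w : ℝ → ℝ → Matrix (Fin n) (Fin n) ℂ) (f : ℝ → Fin n → ℂ)
    (x t : ℝ) : Fin n → ℂ :=
  zeroExt f (t - x) + ∫ s in x..t, w x s *ᵥ zeroExt f (t - s)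

/-- `y` is differentiable in a neighbourhood of `x`, and its derivative has derivative `y₂`
at `x`. -/
def HasSecondDerivAt {n : ℕ} (y : ℝ → Fin n → ℂ) (y₂ : Fin n → ℂ) (x : ℝ) : Prop :=
  ∃ y₁ : ℝ → Fin n → ℂ, (∀ᶠ s in 𝓝 x, HasDerivAt y (y₁ s) s) ∧ HasDerivAt y₁ y₂ x

/-- `y` and `y₁` are summable on `(a,b)` and `y₁` is the weak derivative of `y` there. -/
structure HasWeakDerivL1 {n : ℕ} (a b : ℝ) (y y₁ : ℝ → Fin n → ℂ) : Prop where
  integrable : IntegrableOn y (Ioo a b)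
  integrable_deriv : IntegrableOn y₁ (Ioo a b)
  integral_eq : ∀ φ : ℝ → ℝ, ContDiff ℝ ∞ φ → HasCompactSupport φ → tsupport φ ⊆ Ioo a b →
    ∫ x in Ioo a b, deriv φ x • y x = -∫ x in Ioo a b, φ x • y₁ x

/-- `y` belongs to the Sobolev space `W²₁([a,b]; ℂⁿ)`, with first and second weak derivatives
`y₁` and `y₂`. -/
def HasW21Derivs {n : ℕ} (a b : ℝ) (y y₁ y₂ : ℝ → Fin n → ℂ) : Prop :=
  HasWeakDerivL1 a b y y₁ ∧ HasWeakDerivL1 a b y₁ y₂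

/-!
In the coordinates `(x, σ) = (x, t - x)` the Goursat problem lives on the quadrant `x, σ ≥ 0`.
Integrating over the characteristic rectangle first in time and then in space turns its integral
equation into `z = goursatData q + volterra q z`, where `volterra q z` is a single integral of `q`
against the primitive of `z` in `σ` (`integral_rectangle_eq_volterra`). Only local summability of
`q` is used. The domain of dependence of `(x, σ)` lies in `y + s / 2 ≤ x + σ / 2`, so the operator
gains a power of `σ` there (`norm_volterra_sub_le`). Successive approximations converge locally
uniformly, with factorial estimates, and the solution is unique.

The wave at `(x, t)` is the response `A g (x, t - x)` of the kernel to the boundary signal `g`, the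
continuation of `f` by zero, where `A g (x, σ) = g σ + ∫₀^σ z(x, s) g(σ - s) ds`. Time derivatives
are immediate, since `∂_σ (A g) = A g'` for signals vanishing up to time `0`. For space derivatives
the equation of the kernel is convolved with `g`. With `G` the primitive of `g` this gives
`A g (x, σ) = g σ - ½ ∫ q(y) [A G (y, σ - 2 (y - x)₊) - A G (y, σ - 2 y)] dy`
(`IsVolterraSolution.response_eq`): the integration over time is absorbed in `G`, and `x` enters
only through smooth functions composed with piecewise linear ones. Taylor's formula along these
lines, whose corner at `y = x` produces the term `q u`, and the same equation for `g''` show that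
at fixed `t` the wave is an affine function plus the twofold primitive of `u_tt + q u`
(`IsVolterraSolution.response_eq_twofold_primitive`). As `u_tt + q u` is summable in `x`, the
Lebesgue differentiation theorem gives `u_xx = u_tt + q u` almost everywhere, Fubini's theorem
gives the weak derivatives, and `-u_xx + q u = -u_tt` is continuous.
-/

/-! ### Integrals against a locally integrable coefficient -/

theorem MeasureTheory.LocallyIntegrable.intervalIntegrable_real {E : Type*}
    [NormedAddCommGroup E] {q : ℝ → E}
    (hq : LocallyIntegrable q volume) (a b : ℝ) : IntervalIntegrable q volume a b :=
  intervalIntegrable_iff.mpr <|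
    (hq.integrableOn_isCompact isCompact_uIcc).mono_set uIoc_subset_uIcc

section Bilinear

variable {E F G : Type*} [NormedAddCommGroup E] [NormedSpace ℝ E]
  [NormedAddCommGroup F] [NormedSpace ℝ F] [NormedAddCommGroup G] [NormedSpace ℝ G]

theorem aestronglyMeasurable_bilin {α : Type*} [MeasurableSpace α] {μ : Measure α}
    (L : E →L[ℝ] F →L[ℝ] G) {f : α → E} {g : α → F}
    (hf : AEStronglyMeasurable f μ) (hg : AEStronglyMeasurable g μ) :
    AEStronglyMeasurable (fun x => L (f x) (g x)) μ :=
  L.continuous₂.comp_aestronglyMeasurable (hf.prodMk hg)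

theorem intervalIntegrable_bilin (L : E →L[ℝ] F →L[ℝ] G) {q : ℝ → E}
    (hq : LocallyIntegrable q volume) {k : ℝ → F} (hk : Continuous k) (a b : ℝ) :
    IntervalIntegrable (fun y => L (q y) (k y)) volume a b := by
  obtain ⟨C, hC⟩ := (isCompact_uIcc (a := a) (b := b)).exists_bound_of_continuousOn hk.continuousOn
  have hqi := (hq.intervalIntegrable_real a b).def'
  rw [intervalIntegrable_iff]
  refine Integrable.mono' ((hqi.norm.const_mul ‖L‖).mul_const C)
    (aestronglyMeasurable_bilin L hqi.aestronglyMeasurable hk.aestronglyMeasurable) ?_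
  filter_upwards [ae_restrict_mem measurableSet_uIoc] with y hy
  refine (L.le_opNorm₂ _ _).trans ?_
  gcongr
  exact hC y (uIoc_subset_uIcc hy)

/-- Fubini's theorem for an integrand `L (q y) (K y s)` with `q` locally integrable and `K`
measurable and bounded on the rectangle of integration. -/
theorem intervalIntegral_bilin_swap (L : E →L[ℝ] F →L[ℝ] G) {q : ℝ → E}
    (hq : LocallyIntegrable q volume) {K : ℝ → ℝ → F} (hK : StronglyMeasurable K.uncurry)
    {a b c d C : ℝ} (hC : ∀ y ∈ uIcc a b, ∀ s ∈ uIcc c d, ‖K y s‖ ≤ C) :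
    ∫ y in a..b, ∫ s in c..d, L (q y) (K y s) = ∫ s in c..d, ∫ y in a..b, L (q y) (K y s) := by
  refine intervalIntegral_intervalIntegral_swap ?_
  have hqi := (hq.intervalIntegrable_real a b).def'
  have h1 : Integrable (fun p : ℝ × ℝ => (‖q p.1‖ : ℝ) * (1 : ℝ))
      ((volume.restrict (uIoc a b)).prod (volume.restrict (uIoc c d))) :=
    hqi.norm.mul_prod (g := fun _ => (1 : ℝ)) continuous_const.integrableOn_uIoc
  rw [IntegrableOn, Measure.volume_eq_prod, ← Measure.prod_restrict]
  refine Integrable.mono' ((h1.const_mul ‖L‖).mul_const C)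
    (aestronglyMeasurable_bilin L (hqi.aestronglyMeasurable.comp_fst) hK.aestronglyMeasurable) ?_
  rw [Measure.prod_restrict]
  filter_upwards [ae_restrict_mem (measurableSet_uIoc.prod measurableSet_uIoc)] with p hp
  refine (L.le_opNorm₂ _ _).trans ?_
  rw [mul_one]
  gcongr
  exact hC _ (uIoc_subset_uIcc hp.1) _ (uIoc_subset_uIcc hp.2)

theorem intervalIntegral_bilin_swap_of_continuous (L : E →L[ℝ] F →L[ℝ] G) {q : ℝ → E}
    (hq : LocallyIntegrable q volume) {K : ℝ → ℝ → F} (hK : Continuous K.uncurry)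
    (a b c d : ℝ) :
    ∫ y in a..b, ∫ s in c..d, L (q y) (K y s) = ∫ s in c..d, ∫ y in a..b, L (q y) (K y s) := by
  obtain ⟨C, hC⟩ := ((isCompact_uIcc (a := a) (b := b)).prod
    (isCompact_uIcc (a := c) (b := d))).exists_bound_of_continuousOn hK.continuousOn
  exact intervalIntegral_bilin_swap L hq hK.stronglyMeasurable
    (fun y hy s hs => hC (y, s) ⟨hy, hs⟩)

/-- An integral of a continuous kernel against a locally integrable coefficient depends
continuously on the parameter and on both limits of integration. -/
theorem continuous_intervalIntegral_bilin {X : Type*} [TopologicalSpace X]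
    [FirstCountableTopology X] [LocallyCompactSpace X] (L : E →L[ℝ] F →L[ℝ] G) {q : ℝ → E}
    (hq : LocallyIntegrable q volume) {k : X → ℝ → F} (hk : Continuous k.uncurry)
    {a b : X → ℝ} (ha : Continuous a) (hb : Continuous b) :
    Continuous (fun x => ∫ y in (a x)..(b x), L (q y) (k x y)) := by
  have hkx : ∀ x, Continuous (k x) := fun x => hk.comp (by fun_prop : Continuous fun y => (x, y))
  have key : ∀ b : X → ℝ, Continuous b →
      Continuous (fun x => ∫ y in (0 : ℝ)..(b x), L (q y) (k x y)) := by
    intro b hb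
    rw [continuous_iff_continuousAt]
    intro x₀
    set N : ℝ := |b x₀| + 1 with hN
    have hbN := abs_le.1 (le_refl |b x₀|)
    have hN0 : 0 ≤ |b x₀| := abs_nonneg _
    obtain ⟨S, hS, hxS⟩ := exists_compact_mem_nhds x₀
    obtain ⟨C, hC⟩ := (hS.prod (isCompact_uIcc (a := -N) (b := N))).exists_bound_of_continuousOn
      hk.continuousOn
    have h := intervalIntegral.continuousAt_parametric_primitive_of_dominated (μ := volume)
      (F := fun x y => L (q y) (k x y)) (x₀ := x₀) (a₀ := 0) (b₀ := b x₀)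
      (fun y => ‖L‖ * ‖q y‖ * C) (-N) N ?_ ?_ ?_ ?_ ?_ ?_ (by simp)
    · exact ContinuousAt.comp (f := fun x => (x, b x)) h (by fun_prop)
    · exact fun x => (intervalIntegrable_bilin L hq (hkx x) _ _).def'.aestronglyMeasurable
    · filter_upwards [hxS] with x hx
      filter_upwards [ae_restrict_mem measurableSet_uIoc] with y hy
      refine (L.le_opNorm₂ _ _).trans ?_
      gcongr
      exact hC (x, y) ⟨hx, uIoc_subset_uIcc hy⟩
    · exact ((hq.intervalIntegrable_real _ _).norm.const_mul _).mul_const _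
    · refine ae_of_all _ fun y => ?_
      have : Continuous (fun x => k x y) := hk.comp (by fun_prop : Continuous fun x => (x, y))
      fun_prop
    · constructor <;> linarith
    · constructor <;> linarith
  have hsub := (key b hb).sub (key a ha)
  refine hsub.congr fun x => ?_
  exact intervalIntegral.integral_interval_sub_left (intervalIntegrable_bilin L hq (hkx x) _ _)
    (intervalIntegrable_bilin L hq (hkx x) _ _)

end Bilinear

theorem intervalIntegrable_mul_of_bounded {A : Type*} [NormedRing A] {q S : ℝ → A}
    (hq : LocallyIntegrable q volume) (hS : StronglyMeasurable S) {a b C : ℝ}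
    (hC : ∀ y ∈ uIcc a b, ‖S y‖ ≤ C) :
    IntervalIntegrable (fun y => q y * S y) volume a b := by
  have hqi := (hq.intervalIntegrable_real a b).def'
  rw [intervalIntegrable_iff]
  refine Integrable.mono' (hqi.norm.mul_const C)
    (hqi.aestronglyMeasurable.mul hS.aestronglyMeasurable) ?_
  filter_upwards [ae_restrict_mem measurableSet_uIoc] with y hy
  refine (norm_mul_le _ _).trans ?_
  gcongr
  exact hC y (uIoc_subset_uIcc hy)

/-! ### The Volterra equation in the coordinates `(x, σ) = (x, t - x)` -/

/-- The primitive in the second variable of `z y`, vanishing at `0` and continued by zero to the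
negative half-line. -/
noncomputable def causalPrim {E : Type*} [NormedAddCommGroup E] [NormedSpace ℝ E]
    (z : ℝ → ℝ → E) (y s : ℝ) : E :=
  ∫ r in (0 : ℝ)..max s 0, z y r

section CausalPrim

variable {E : Type*} [NormedAddCommGroup E] [NormedSpace ℝ E] {z : ℝ → ℝ → E}

theorem continuous_causalPrim (hz : Continuous z.uncurry) :
    Continuous (causalPrim z).uncurry := by
  have : Continuous (fun p : (ℝ × ℝ) × ℝ => z p.1.1 p.2) :=
    hz.comp (by fun_prop : Continuous fun p : (ℝ × ℝ) × ℝ => (p.1.1, p.2))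
  exact intervalIntegral.continuous_parametric_intervalIntegral_of_continuous
    (f := fun (p : ℝ × ℝ) r => z p.1 r) (s := fun p => max p.2 0) this (by fun_prop)

theorem continuous_causalPrim_comp (hz : Continuous z.uncurry) {X : Type*} [TopologicalSpace X]
    {a b : X → ℝ} (ha : Continuous a) (hb : Continuous b) :
    Continuous fun x => causalPrim z (a x) (b x) :=
  (continuous_causalPrim hz).comp (ha.prodMk hb)

theorem causalPrim_of_nonpos {y s : ℝ} (hs : s ≤ 0) : causalPrim z y s = 0 := by
  simp [causalPrim, max_eq_right hs]

theorem causalPrim_of_nonneg {y s : ℝ} (hs : 0 ≤ s) :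
    causalPrim z y s = ∫ r in (0 : ℝ)..s, z y r := by
  simp [causalPrim, max_eq_left hs]

end CausalPrim

section Volterra

variable {A : Type*} [NormedRing A] [NormedAlgebra ℝ A]

/-- The values on the characteristics that the Goursat data prescribe for the kernel: the
inhomogeneous term of the integral equation. -/
noncomputable def goursatData (q : ℝ → A) (x σ : ℝ) : A :=
  -((1 / 2 : ℝ) • ∫ y in (σ / 2)..(x + σ / 2), q y)

/-- The Volterra operator of the Goursat problem in the coordinates `(x, σ) = (x, t - x)`. The
double integral over the characteristic rectangle is written as one integral in the space variable
`y`; the inner integral over `s`, in which `q` is constant, is a difference of values of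
`causalPrim z y`. -/
noncomputable def volterra (q : ℝ → A) (z : ℝ → ℝ → A) (x σ : ℝ) : A :=
  -((1 / 2 : ℝ) • ∫ y in (0 : ℝ)..(x + σ / 2),
    q y * (causalPrim z y (σ - 2 * max (y - x) 0) - causalPrim z y (σ - 2 * y)))

variable {q : ℝ → A}

theorem continuous_goursatData (hq : LocallyIntegrable q volume) :
    Continuous (goursatData q).uncurry := by
  have h := continuous_intervalIntegral_bilin (X := ℝ × ℝ) (ContinuousLinearMap.mul ℝ A) hq
    (k := fun _ _ => 1) continuous_const (a := fun p => p.2 / 2) (b := fun p => p.1 + p.2 / 2)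
    (by fun_prop) (by fun_prop)
  simp only [ContinuousLinearMap.mul_apply', mul_one] at h
  exact (h.const_smul (1 / 2 : ℝ)).neg

theorem continuous_volterra (hq : LocallyIntegrable q volume) {z : ℝ → ℝ → A}
    (hz : Continuous z.uncurry) : Continuous (volterra q z).uncurry := by
  have h := continuous_intervalIntegral_bilin (X := ℝ × ℝ) (ContinuousLinearMap.mul ℝ A) hq
    (k := fun p y => causalPrim z y (p.2 - 2 * max (y - p.1) 0) - causalPrim z y (p.2 - 2 * y))
    ((continuous_causalPrim_comp hz (by fun_prop) (by fun_prop)).sub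
      (continuous_causalPrim_comp hz (by fun_prop) (by fun_prop)))
    (a := fun p => 0) (b := fun p => p.1 + p.2 / 2) (by fun_prop) (by fun_prop)
  simp only [ContinuousLinearMap.mul_apply'] at h
  exact (h.const_smul (1 / 2 : ℝ)).neg

/-- The Volterra estimate. The region `y + s / 2 ≤ R` is the domain of dependence, so a bound of
order `s ^ k` there for `a - b` gives one of order `σ ^ (k + 1)` for the images of `a` and `b`. -/
theorem norm_volterra_sub_le (hq : LocallyIntegrable q volume) {a b : ℝ → ℝ → A}
    (ha : Continuous a.uncurry) (hb : Continuous b.uncurry) {R C : ℝ} {k : ℕ} (hC : 0 ≤ C)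
    (hab : ∀ y s, 0 ≤ y → 0 ≤ s → y + s / 2 ≤ R → ‖a y s - b y s‖ ≤ C * s ^ k)
    {x σ : ℝ} (hx : 0 ≤ x) (hσ : 0 ≤ σ) (hR : x + σ / 2 ≤ R) :
    ‖volterra q a x σ - volterra q b x σ‖
      ≤ C * (∫ y in (0 : ℝ)..R, ‖q y‖) * (σ ^ (k + 1) / (k + 1)) := by
  have hay : ∀ y, Continuous (a y) := fun y => ha.comp (by fun_prop : Continuous fun s => (y, s))
  have hby : ∀ y, Continuous (b y) := fun y => hb.comp (by fun_prop : Continuous fun s => (y, s))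
  have hint : ∀ z : ℝ → ℝ → A, Continuous z.uncurry → IntervalIntegrable (fun y =>
      q y * (causalPrim z y (σ - 2 * max (y - x) 0) - causalPrim z y (σ - 2 * y)))
      volume 0 (x + σ / 2) := fun z hz =>
    intervalIntegrable_bilin (ContinuousLinearMap.mul ℝ A) hq
      ((continuous_causalPrim_comp hz (by fun_prop) (by fun_prop)).sub
      (continuous_causalPrim_comp hz (by fun_prop) (by fun_prop))) _ _
  have hY : 0 ≤ x + σ / 2 := by positivity
  set D : ℝ := σ ^ (k + 1) / (k + 1) with hD
  have hD0 : 0 ≤ D := by positivity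
  have hpt : ∀ y ∈ Ioc 0 (x + σ / 2),
      ‖q y * (causalPrim a y (σ - 2 * max (y - x) 0) - causalPrim a y (σ - 2 * y))
        - q y * (causalPrim b y (σ - 2 * max (y - x) 0) - causalPrim b y (σ - 2 * y))‖
        ≤ ‖q y‖ * (C * D) := by
    intro y hy
    have hm0 : 0 ≤ max (y - x) 0 := le_max_right _ _
    have hmy : max (y - x) 0 ≤ y := max_le (by linarith) hy.1.le
    have hmx : y - x ≤ max (y - x) 0 := le_max_left _ _
    have hup : 0 ≤ σ - 2 * max (y - x) 0 := by
      have : max (y - x) 0 ≤ σ / 2 := max_le (by linarith [hy.2]) (by positivity)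
      linarith
    rw [← mul_sub]
    refine (norm_mul_le _ _).trans ?_
    gcongr
    have e : ∀ z : ℝ → ℝ → A, Continuous (z y) →
        causalPrim z y (σ - 2 * max (y - x) 0) - causalPrim z y (σ - 2 * y)
          = ∫ r in (max (σ - 2 * y) 0)..(σ - 2 * max (y - x) 0), z y r := by
      intro z hz
      rw [causalPrim_of_nonneg hup, causalPrim]
      exact intervalIntegral.integral_interval_sub_left (hz.intervalIntegrable _ _)
        (hz.intervalIntegrable _ _)
    rw [e a (hay y), e b (hby y), ← intervalIntegral.integral_sub
      ((hay y).intervalIntegrable _ _) ((hby y).intervalIntegrable _ _)]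
    have hlo : max (σ - 2 * y) 0 ≤ σ - 2 * max (y - x) 0 := max_le (by linarith) hup
    calc ‖∫ r in (max (σ - 2 * y) 0)..(σ - 2 * max (y - x) 0), (a y r - b y r)‖
        ≤ ∫ r in (max (σ - 2 * y) 0)..(σ - 2 * max (y - x) 0), C * r ^ k := by
          refine intervalIntegral.norm_integral_le_of_norm_le hlo (ae_of_all _ fun r hr => ?_)
            (Continuous.intervalIntegrable (by fun_prop) _ _)
          have hr0 : 0 ≤ r := (le_max_right _ _).trans hr.1.le
          exact hab y r hy.1.le hr0 (by linarith [hr.2])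
      _ ≤ ∫ r in (0 : ℝ)..σ, C * r ^ k := by
          refine intervalIntegral.integral_mono_interval (le_max_right _ _) hlo (by linarith) ?_
            (Continuous.intervalIntegrable (by fun_prop) _ _)
          filter_upwards [ae_restrict_mem measurableSet_Ioc] with r hr
          have := hr.1.le
          simp only [Pi.zero_apply]
          positivity
      _ = C * D := by simp [hD]
  rw [volterra, volterra, neg_sub_neg, ← smul_sub, ← intervalIntegral.integral_sub (hint b hb)
    (hint a ha), norm_smul]
  have hI : 0 ≤ ∫ y in (0 : ℝ)..R, ‖q y‖ :=
    intervalIntegral.integral_nonneg (hY.trans hR) fun _ _ => norm_nonneg _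
  calc ‖(1 / 2 : ℝ)‖ * _ ≤ 1 * ∫ y in (0 : ℝ)..(x + σ / 2), ‖q y‖ * (C * D) := by
        gcongr
        · norm_num
        · refine intervalIntegral.norm_integral_le_of_norm_le hY (ae_of_all _ fun y hy => ?_)
            ((hq.intervalIntegrable_real _ _).norm.mul_const _)
          rw [norm_sub_rev]
          exact hpt y hy
    _ ≤ (∫ y in (0 : ℝ)..R, ‖q y‖) * (C * D) := by
        rw [intervalIntegral.integral_mul_const, one_mul]
        gcongr
        refine intervalIntegral.integral_mono_interval le_rfl hY hR
          (ae_of_all _ fun _ => norm_nonneg _) (hq.intervalIntegrable_real _ _).norm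
    _ = _ := by ring

/-- `z` solves the Volterra form of the Goursat problem on the quadrant `x ≥ 0`, `σ ≥ 0`. -/
def IsVolterraSolution (q : ℝ → A) (z : ℝ → ℝ → A) : Prop :=
  ∀ x σ, 0 ≤ x → 0 ≤ σ → z x σ = goursatData q x σ + volterra q z x σ

theorem exists_bound_on_dependence_domain {E : Type*} [NormedAddCommGroup E] {f : ℝ → ℝ → E}
    (hf : Continuous f.uncurry) (R : ℝ) :
    ∃ C, 0 ≤ C ∧ ∀ y s, 0 ≤ y → 0 ≤ s → y + s / 2 ≤ R → ‖f y s‖ ≤ C := by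
  obtain ⟨C, hC⟩ := ((isCompact_Icc (a := 0) (b := R)).prod
    (isCompact_Icc (a := 0) (b := 2 * R))).exists_bound_of_continuousOn hf.continuousOn
  refine ⟨max C 0, le_max_right _ _, fun y s hy hs hR => (hC (y, s) ?_).trans (le_max_left _ _)⟩
  constructor <;> constructor <;> simp <;> linarith

theorem IsVolterraSolution.unique (hq : LocallyIntegrable q volume) {z z' : ℝ → ℝ → A}
    (hz : Continuous z.uncurry) (hz' : Continuous z'.uncurry) (h : IsVolterraSolution q z)
    (h' : IsVolterraSolution q z') {x σ : ℝ} (hx : 0 ≤ x) (hσ : 0 ≤ σ) : z x σ = z' x σ := by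
  set R := x + σ / 2 with hR
  obtain ⟨C, hC0, hC⟩ := exists_bound_on_dependence_domain
    (f := fun y s => z y s - z' y s) (hz.sub hz') R
  set B := ∫ y in (0 : ℝ)..R, ‖q y‖ with hBdef
  have hB : 0 ≤ B :=
    intervalIntegral.integral_nonneg (by positivity) fun _ _ => norm_nonneg _
  have key : ∀ k : ℕ, ∀ y s, 0 ≤ y → 0 ≤ s → y + s / 2 ≤ R →
      ‖z y s - z' y s‖ ≤ C * B ^ k / k.factorial * s ^ k := by
    intro k
    induction k with
    | zero => intro y s hy hs hys; simpa using hC y s hy hs hys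
    | succ k ih =>
      intro y s hy hs hys
      rw [h y s hy hs, h' y s hy hs, add_sub_add_left_eq_sub]
      refine (norm_volterra_sub_le hq hz hz' (by positivity) ih hy hs hys).trans (le_of_eq ?_)
      rw [Nat.factorial_succ]
      push_cast
      rw [← hBdef]
      field_simp
      ring
  have lim : Tendsto (fun k : ℕ => C * B ^ k / k.factorial * σ ^ k) atTop (𝓝 0) := by
    have := (FloorSemiring.tendsto_pow_div_factorial_atTop (B * σ)).const_mul C
    rw [mul_zero] at this
    refine this.congr fun k => ?_
    rw [mul_pow]; ring
  have : ‖z x σ - z' x σ‖ ≤ 0 := ge_of_tendsto' lim fun k => key k x σ hx hσ le_rfl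
  exact sub_eq_zero.1 (norm_le_zero_iff.1 this)

/-- The successive approximations of the Volterra equation, started at `0`. -/
noncomputable def picardIterate (q : ℝ → A) : ℕ → ℝ → ℝ → A
  | 0 => fun _ _ => 0
  | k + 1 => fun x σ => goursatData q x σ + volterra q (picardIterate q k) x σ

theorem continuous_picardIterate (hq : LocallyIntegrable q volume) (k : ℕ) :
    Continuous (picardIterate q k).uncurry := by
  induction k with
  | zero => exact continuous_const
  | succ k ih => exact (continuous_goursatData hq).add (continuous_volterra hq ih)

theorem exists_norm_picardIterate_succ_sub_le (hq : LocallyIntegrable q volume) {R : ℝ} :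
    ∃ u : ℕ → ℝ, Summable u ∧ ∀ k y s, 0 ≤ y → 0 ≤ s → y + s / 2 ≤ R →
      ‖picardIterate q (k + 1) y s - picardIterate q k y s‖ ≤ u k := by
  rcases lt_or_ge R 0 with hR | hR
  · exact ⟨0, summable_zero, fun k y s hy hs hys => by linarith⟩
  obtain ⟨C, hC0, hC⟩ := exists_bound_on_dependence_domain (continuous_picardIterate hq 1) R
  set B := ∫ y in (0 : ℝ)..R, ‖q y‖ with hBdef
  have hB : 0 ≤ B := intervalIntegral.integral_nonneg hR fun _ _ => norm_nonneg _
  have key : ∀ k : ℕ, ∀ y s, 0 ≤ y → 0 ≤ s → y + s / 2 ≤ R →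
      ‖picardIterate q (k + 1) y s - picardIterate q k y s‖
        ≤ C * B ^ k / k.factorial * s ^ k := by
    intro k
    induction k with
    | zero =>
      intro y s hy hs hys
      have := hC y s hy hs hys
      rw [zero_add, show picardIterate q 0 y s = 0 from rfl]
      simpa using this
    | succ k ih =>
      intro y s hy hs hys
      rw [picardIterate, show picardIterate q (k + 1) y s
        = goursatData q y s + volterra q (picardIterate q k) y s from rfl, add_sub_add_left_eq_sub]
      refine (norm_volterra_sub_le hq (continuous_picardIterate hq _)
        (continuous_picardIterate hq _) (by positivity) ih hy hs hys).trans (le_of_eq ?_)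
      rw [Nat.factorial_succ]
      push_cast
      rw [← hBdef]
      field_simp
      ring
  refine ⟨fun k => C * ((B * (2 * R)) ^ k / k.factorial),
    (Real.summable_pow_div_factorial _).mul_left C, fun k y s hy hs hys => ?_⟩
  have : s ≤ 2 * R := by linarith
  calc _ ≤ C * B ^ k / k.factorial * s ^ k := key k y s hy hs hys
    _ ≤ C * B ^ k / k.factorial * (2 * R) ^ k := by gcongr
    _ = _ := by rw [mul_pow]; ring

/-- The limit of the successive approximations. Continuity holds on the whole plane because the
limit is continued from the quadrant by projecting onto it. -/
theorem exists_tendstoUniformlyOn_picardIterate [CompleteSpace A]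
    (hq : LocallyIntegrable q volume) :
    ∃ z : ℝ → ℝ → A, Continuous z.uncurry ∧ ∀ R, TendstoUniformlyOn
      (fun N => (picardIterate q N).uncurry) z.uncurry atTop
      {p | 0 ≤ p.1 ∧ 0 ≤ p.2 ∧ p.1 + p.2 / 2 ≤ R} := by
  let d : ℕ → ℝ × ℝ → A := fun k p => picardIterate q (k + 1) p.1 p.2 - picardIterate q k p.1 p.2
  have hsum : ∀ N p, ∑ k ∈ Finset.range N, d k p = (picardIterate q N).uncurry p := by
    intro N p
    have := Finset.sum_range_sub (fun k => picardIterate q k p.1 p.2) N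
    rw [this]
    simp [picardIterate, Function.uncurry]
  have hunif : ∀ R, TendstoUniformlyOn (fun N => (picardIterate q N).uncurry)
      (fun p => ∑' k, d k p) atTop {p | 0 ≤ p.1 ∧ 0 ≤ p.2 ∧ p.1 + p.2 / 2 ≤ R} := by
    intro R
    obtain ⟨u, hu, hb⟩ := exists_norm_picardIterate_succ_sub_le hq (R := R)
    have := tendstoUniformlyOn_tsum_nat (f := d) hu
      (s := {p | 0 ≤ p.1 ∧ 0 ≤ p.2 ∧ p.1 + p.2 / 2 ≤ R})
      fun k p hp => hb k p.1 p.2 hp.1 hp.2.1 hp.2.2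
    exact this.congr (Eventually.of_forall fun N p _ => hsum N p)
  let pr : ℝ × ℝ → ℝ × ℝ := fun p => (max p.1 0, max p.2 0)
  have hpr : Continuous pr := by fun_prop
  refine ⟨fun x σ => ∑' k, d k (pr (x, σ)), ?_, fun R => (hunif R).congr_right ?_⟩
  · rw [continuous_iff_continuousAt]
    intro p
    have hnhds : {p' : ℝ × ℝ | (pr p').1 + (pr p').2 / 2 < (pr p).1 + (pr p).2 / 2 + 1} ∈ 𝓝 p :=
      (isOpen_lt (by fun_prop) continuous_const).mem_nhds (lt_add_one ((pr p).1 + (pr p).2 / 2))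
    have h1 := (hunif ((pr p).1 + (pr p).2 / 2 + 1)).continuousOn
      (Frequently.of_forall fun N => (continuous_picardIterate hq N).continuousOn)
    exact (h1.comp hpr.continuousOn fun p' hp' =>
      ⟨le_max_right _ _, le_max_right _ _, le_of_lt hp'⟩).continuousAt hnhds
  · rintro ⟨x, σ⟩ ⟨hx, hσ, -⟩
    have hx : 0 ≤ x := hx
    have hσ : 0 ≤ σ := hσ
    simp [Function.uncurry, pr, max_eq_left hx, max_eq_left hσ]

theorem exists_isVolterraSolution [CompleteSpace A] (hq : LocallyIntegrable q volume) :
    ∃ z : ℝ → ℝ → A, Continuous z.uncurry ∧ IsVolterraSolution q z := by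
  obtain ⟨z, hcont, hunif⟩ := exists_tendstoUniformlyOn_picardIterate hq
  refine ⟨z, hcont, fun x σ hx hσ => ?_⟩
  set R := x + σ / 2
  have hlim1 : Tendsto (fun N => picardIterate q (N + 1) x σ) atTop (𝓝 (z x σ)) :=
    ((hunif R).tendsto_at (x := (x, σ)) ⟨hx, hσ, le_rfl⟩).comp (tendsto_add_atTop_nat 1)
  refine tendsto_nhds_unique hlim1 (Tendsto.const_add _ ?_)
  rw [Metric.tendsto_atTop]
  intro ε hε
  set B := ∫ y in (0 : ℝ)..R, ‖q y‖ with hBdef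
  have hB : 0 ≤ B := intervalIntegral.integral_nonneg (by positivity) fun _ _ => norm_nonneg _
  set δ : ℝ := ε / (B * σ + 1) with hδ
  have hδ0 : 0 < δ := by positivity
  obtain ⟨N₀, hN₀⟩ := eventually_atTop.1 (Metric.tendstoUniformlyOn_iff.1 (hunif R) δ hδ0)
  refine ⟨N₀, fun N hN => ?_⟩
  rw [dist_eq_norm]
  have h3 := norm_volterra_sub_le hq (continuous_picardIterate hq N) hcont (R := R) (k := 0)
    hδ0.le (fun y s hy hs hys => by
      have := hN₀ N hN (y, s) ⟨hy, hs, hys⟩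
      rw [dist_comm, dist_eq_norm] at this
      simpa using this.le) hx hσ le_rfl
  refine h3.trans_lt ?_
  have : δ * (B * σ + 1) = ε := by rw [hδ]; field_simp
  rw [← hBdef]
  norm_num
  nlinarith

end Volterra

/-! ### Integration over the characteristic rectangle -/

/-- The section at `y` of the characteristic rectangle is an interval, over which `z y` integrates
to a difference of values of `causalPrim z y`. -/
theorem integral_indicator_rectangle {E : Type*} [NormedAddCommGroup E] [NormedSpace ℝ E]
    {z : ℝ → ℝ → E} (hz : Continuous z.uncurry) {x σ y : ℝ} (hx : 0 ≤ x)
    (hσ : 0 ≤ σ) (hy : 0 ≤ y) (hy' : y ≤ x + σ / 2) :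
    ∫ s in (0 : ℝ)..σ, (Ioc (σ - 2 * y) (σ - 2 * y + 2 * x)).indicator (z y) s
      = causalPrim z y (σ - 2 * max (y - x) 0) - causalPrim z y (σ - 2 * y) := by
  have hzy : Continuous (z y) := hz.comp (by fun_prop : Continuous fun s => (y, s))
  have hmin : min σ (σ - 2 * y + 2 * x) = σ - 2 * max (y - x) 0 := by
    rcases le_total (y - x) 0 with h | h
    · rw [max_eq_right h, min_eq_left (by linarith)]; ring
    · rw [max_eq_left h, min_eq_right (by linarith)]; ring
  have hup : 0 ≤ σ - 2 * max (y - x) 0 := by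
    rw [← hmin]; exact le_min hσ (by linarith)
  have hlo : max 0 (σ - 2 * y) ≤ σ - 2 * max (y - x) 0 := by
    rw [← hmin]
    exact le_min (max_le hσ (by linarith)) (max_le (by linarith) (by linarith))
  rw [intervalIntegral.integral_of_le hσ, setIntegral_indicator measurableSet_Ioc, Ioc_inter_Ioc,
     hmin, ← intervalIntegral.integral_of_le hlo, causalPrim_of_nonneg hup,
    causalPrim, max_comm]
  exact (intervalIntegral.integral_interval_sub_left (hzy.intervalIntegrable _ _)
    (hzy.intervalIntegrable _ _)).symm

theorem stronglyMeasurable_indicator_rectangle {E : Type*} [NormedAddCommGroup E]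
    {z : ℝ → ℝ → E} (hz : Continuous z.uncurry) (x σ : ℝ) :
    StronglyMeasurable (Function.uncurry fun y s =>
      (Ioc (σ - 2 * y) (σ - 2 * y + 2 * x)).indicator (z y) s) := by
  have hS : MeasurableSet ({p : ℝ × ℝ | σ - 2 * p.1 < p.2} ∩
      {p : ℝ × ℝ | p.2 ≤ σ - 2 * p.1 + 2 * x}) :=
    (measurableSet_lt (by fun_prop) (by fun_prop)).inter
      (measurableSet_le (by fun_prop) (by fun_prop))
  exact hz.stronglyMeasurable.indicator hS

section Rectangle

variable {A : Type*} [NormedRing A] [NormedAlgebra ℝ A] {q : ℝ → A} {z : ℝ → ℝ → A}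

theorem integral_characteristic_line (q : ℝ → A) (z : ℝ → ℝ → A) {x σ s : ℝ} (hx : 0 ≤ x)
    (hs : 0 ≤ s) (hsσ : s ≤ σ) :
    ∫ η in σ..(σ + 2 * x), q ((η - s) / 2) * z ((η - s) / 2) s
      = (2 : ℝ) • ∫ y in (0 : ℝ)..(x + σ / 2),
          q y * (Ioc (σ - 2 * y) (σ - 2 * y + 2 * x)).indicator (z y) s := by
  have h1 : ∀ y, q y * (Ioc (σ - 2 * y) (σ - 2 * y + 2 * x)).indicator (z y) s
      = (Ioc ((σ - s) / 2) ((σ - s) / 2 + x)).indicator (fun y => q y * z y s) y := by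
    intro y
    by_cases h : s ∈ Ioc (σ - 2 * y) (σ - 2 * y + 2 * x)
    · have h' : y ∈ Ioc ((σ - s) / 2) ((σ - s) / 2 + x) :=
        ⟨by linarith [h.1], by linarith [h.2]⟩
      rw [indicator_of_mem h, indicator_of_mem h']
    · have h' : y ∉ Ioc ((σ - s) / 2) ((σ - s) / 2 + x) := fun h' =>
        h ⟨by linarith [h'.1], by linarith [h'.2]⟩
      rw [indicator_of_notMem h, indicator_of_notMem h', mul_zero]
  simp only [h1]
  have hsub := intervalIntegral.integral_comp_div_sub (a := σ) (b := σ + 2 * x)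
    (fun y => q y * z y s) (two_ne_zero) (s / 2)
  simp only [← sub_div] at hsub
  rw [hsub, intervalIntegral.integral_of_le (b := x + σ / 2) (by linarith),
    setIntegral_indicator measurableSet_Ioc, Ioc_inter_Ioc, 
    max_eq_right (by linarith), min_eq_right (by linarith),
    ← intervalIntegral.integral_of_le (by linarith)]
  congr 2
  ring

/-- The double integral of the Goursat problem, in the characteristic variables, is the Volterra
operator. -/
theorem integral_rectangle_eq_volterra [CompleteSpace A] (hq : LocallyIntegrable q volume)
    (hz : Continuous z.uncurry) {x σ : ℝ} (hx : 0 ≤ x) (hσ : 0 ≤ σ) :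
    -((1 / 4 : ℝ) • ∫ s in (0 : ℝ)..σ, ∫ η in σ..(σ + 2 * x),
      q ((η - s) / 2) * z ((η - s) / 2) s) = volterra q z x σ := by
  have hY : 0 ≤ x + σ / 2 := by positivity
  obtain ⟨C, hC⟩ := ((isCompact_uIcc (a := 0) (b := x + σ / 2)).prod
    (isCompact_uIcc (a := 0) (b := σ))).exists_bound_of_continuousOn hz.continuousOn
  have hswap := intervalIntegral_bilin_swap (ContinuousLinearMap.mul ℝ A) hq
    (stronglyMeasurable_indicator_rectangle hz x σ) (a := 0) (b := x + σ / 2) (c := 0) (d := σ)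
    (fun y hy s hs => (norm_indicator_le_norm_self _ _).trans (hC (y, s) ⟨hy, hs⟩))
  simp only [ContinuousLinearMap.mul_apply'] at hswap
  have h1 : ∫ s in (0 : ℝ)..σ, ∫ η in σ..(σ + 2 * x), q ((η - s) / 2) * z ((η - s) / 2) s
      = (2 : ℝ) • ∫ s in (0 : ℝ)..σ, ∫ y in (0 : ℝ)..(x + σ / 2),
          q y * (Ioc (σ - 2 * y) (σ - 2 * y + 2 * x)).indicator (z y) s := by
    rw [← intervalIntegral.integral_smul]
    refine intervalIntegral.integral_congr fun s hs => ?_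
    rw [uIcc_of_le hσ] at hs
    exact integral_characteristic_line q z hx hs.1 hs.2
  rw [h1, ← hswap, smul_smul, volterra]
  norm_num only
  congr 2
  refine intervalIntegral.integral_congr fun y hy => ?_
  rw [uIcc_of_le hY] at hy
  have hzy : Continuous (z y) := hz.comp (by fun_prop : Continuous fun s => (y, s))
  have hint : IntervalIntegrable (fun s => (Ioc (σ - 2 * y) (σ - 2 * y + 2 * x)).indicator (z y) s)
      volume 0 σ := by
    rw [intervalIntegrable_iff]
    exact (hzy.intervalIntegrable _ _).def'.indicator measurableSet_Ioc
  rw [← integral_indicator_rectangle hz hx hσ hy.1 hy.2]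
  exact (ContinuousLinearMap.mul ℝ A (q y)).intervalIntegral_comp_comm hint

end Rectangle

/-! ### Causal signals and the response of the kernel -/

section Response

variable {V : Type*} [NormedAddCommGroup V] [NormedSpace ℝ V]

/-- A signal that vanishes up to time `0`. -/
def IsCausal (g : ℝ → V) : Prop := ∀ s ≤ 0, g s = 0

/-- The wave caused by the boundary signal `g`, at the point `x` and the retarded time
`σ = t - x`, when the propagation kernel is `z` in the coordinates `(x, σ)`. -/
noncomputable def response (z : ℝ → ℝ → V →L[ℝ] V) (g : ℝ → V) (x σ : ℝ) : V :=
  g σ + ∫ s in (0 : ℝ)..σ, z x s (g (σ - s))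

variable {z : ℝ → ℝ → V →L[ℝ] V} {g G : ℝ → V}

theorem continuous_response (hz : Continuous z.uncurry) (hg : Continuous g) :
    Continuous (response z g).uncurry := by
  have h : Continuous (fun p : (ℝ × ℝ) × ℝ => z p.1.1 p.2 (g (p.1.2 - p.2))) :=
    (hz.comp (by fun_prop : Continuous fun p : (ℝ × ℝ) × ℝ => (p.1.1, p.2))).clm_apply
      (by fun_prop)
  exact (hg.comp continuous_snd).add
    (intervalIntegral.continuous_parametric_intervalIntegral_of_continuous
      (f := fun (p : ℝ × ℝ) r => z p.1 r (g (p.2 - r))) (s := fun p => p.2) h (by fun_prop))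

theorem continuous_response_comp (hz : Continuous z.uncurry) (hg : Continuous g) {X : Type*}
    [TopologicalSpace X] {a b : X → ℝ} (ha : Continuous a) (hb : Continuous b) :
    Continuous fun x => response z g (a x) (b x) :=
  (continuous_response hz hg).comp (ha.prodMk hb)

/-- For a causal signal the upper limit of the convolution may be taken to be any larger number. -/
theorem IsCausal.integral_conv_eq (hG : IsCausal G) (hGc : Continuous G) {k : ℝ → V →L[ℝ] V}
    (hk : Continuous k) {σ b : ℝ} (h : σ ≤ b) :
    ∫ s in (0 : ℝ)..σ, k s (G (σ - s)) = ∫ s in (0 : ℝ)..b, k s (G (σ - s)) := by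
  have hi : ∀ c d, IntervalIntegrable (fun s => k s (G (σ - s))) volume c d := fun c d =>
    Continuous.intervalIntegrable (hk.clm_apply (by fun_prop)) _ _
  rw [← intervalIntegral.integral_add_adjacent_intervals (hi 0 σ) (hi σ b), left_eq_add]
  refine intervalIntegral.integral_zero_ae (ae_of_all _ fun s hs => ?_)
  rw [uIoc_of_le h] at hs
  rw [hG _ (by linarith [hs.1]), map_zero]

theorem IsCausal.integral_conv_of_nonpos (hG : IsCausal G) {k : ℝ → V →L[ℝ] V} {σ : ℝ}
    (h : σ ≤ 0) : ∫ s in (0 : ℝ)..σ, k s (G (σ - s)) = 0 := by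
  refine intervalIntegral.integral_zero_ae (ae_of_all _ fun s hs => ?_)
  rw [uIoc_of_ge h] at hs
  rw [hG _ (by linarith [hs.1]), map_zero]

theorem IsCausal.response (hG : IsCausal G) (x : ℝ) : IsCausal (response z G x) := fun σ hσ => by
  rw [_root_.response, hG σ hσ, hG.integral_conv_of_nonpos hσ, add_zero]

/-- Differentiating a convolution with a causal signal differentiates the signal: no boundary term
arises since the signal vanishes at `0`. -/
theorem IsCausal.hasDerivAt_conv (hG : IsCausal G) (hg : IsCausal g)
    (hGg : ∀ s, HasDerivAt G (g s) s) (hgc : Continuous g) {k : ℝ → V →L[ℝ] V}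
    (hk : Continuous k) (σ : ℝ) :
    HasDerivAt (fun σ => ∫ s in (0 : ℝ)..σ, k s (G (σ - s)))
      (∫ s in (0 : ℝ)..σ, k s (g (σ - s))) σ := by
  have hGc : Continuous G := continuous_iff_continuousAt.2 fun s => (hGg s).continuousAt
  rw [hg.integral_conv_eq hgc hk (lt_add_one σ).le]
  have hkg : Continuous fun p : ℝ × ℝ => k p.2 (g (p.1 - p.2)) :=
    (by fun_prop : Continuous fun p : ℝ × ℝ => k p.2).clm_apply (by fun_prop)
  obtain ⟨C, hC⟩ := ((isCompact_Icc (a := σ - 1) (b := σ + 1)).prod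
    (isCompact_uIcc (a := 0) (b := σ + 1))).exists_bound_of_continuousOn hkg.continuousOn
  have h := (intervalIntegral.hasDerivAt_integral_of_dominated_loc_of_deriv_le (μ := volume)
    (a := 0) (b := σ + 1) (F := fun τ s => k s (G (τ - s))) (F' := fun τ s => k s (g (τ - s)))
    (x₀ := σ) (s := Icc (σ - 1) (σ + 1)) (bound := fun _ => C)
    (Icc_mem_nhds (by linarith) (by linarith))
    (Eventually.of_forall fun τ => (hk.clm_apply (by fun_prop)).aestronglyMeasurable)
    ((hk.clm_apply (by fun_prop)).intervalIntegrable _ _)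
    (hk.clm_apply (by fun_prop)).aestronglyMeasurable
    (ae_of_all _ fun s hs τ hτ => hC (τ, s) ⟨hτ, uIoc_subset_uIcc hs⟩)
    intervalIntegrable_const
    (ae_of_all _ fun s _ τ _ => (k s).hasFDerivAt.comp_hasDerivAt τ
      ((hGg (τ - s)).comp_sub_const τ s))).2
  refine h.congr_of_eventuallyEq ?_
  filter_upwards [Iio_mem_nhds (lt_add_one σ)] with τ hτ
  exact hG.integral_conv_eq hGc hk (le_of_lt hτ)

theorem IsCausal.hasDerivAt_response (hG : IsCausal G) (hg : IsCausal g)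
    (hGg : ∀ s, HasDerivAt G (g s) s) (hgc : Continuous g) (hz : Continuous z.uncurry) (x σ : ℝ) :
    HasDerivAt (_root_.response z G x) (_root_.response z g x σ) σ :=
  (hGg σ).add (hG.hasDerivAt_conv hg hGg hgc
    (hz.comp (by fun_prop : Continuous fun s => (x, s))) σ)

/-- The response to the Heaviside step. -/
noncomputable def stepResponse (z : ℝ → ℝ → V →L[ℝ] V) (x σ : ℝ) : V →L[ℝ] V :=
  (Ici (0 : ℝ)).indicator (fun _ => 1) σ + causalPrim z x σ

theorem stepResponse_of_neg {x σ : ℝ} (h : σ < 0) : stepResponse z x σ = 0 := by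
  rw [stepResponse, indicator_of_notMem (by simpa using h), causalPrim_of_nonpos h.le, add_zero]

theorem stepResponse_of_nonneg {x σ : ℝ} (h : 0 ≤ σ) :
    stepResponse z x σ = 1 + ∫ s in (0 : ℝ)..σ, z x s := by
  rw [stepResponse, indicator_of_mem (by simpa using h), causalPrim_of_nonneg h]

theorem stronglyMeasurable_stepResponse (hz : Continuous z.uncurry) :
    StronglyMeasurable (stepResponse z).uncurry := by
  have h : StronglyMeasurable fun p : ℝ × ℝ =>
      (Ici (0 : ℝ)).indicator (fun _ => (1 : V →L[ℝ] V)) p.2 :=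
    (stronglyMeasurable_const.indicator measurableSet_Ici).comp_measurable measurable_snd
  exact h.add (continuous_causalPrim hz).stronglyMeasurable

theorem norm_stepResponse_le (x σ : ℝ) :
    ‖stepResponse z x σ‖ ≤ ‖(1 : V →L[ℝ] V)‖ + ‖causalPrim z x σ‖ :=
  (norm_add_le _ _).trans (by gcongr; exact norm_indicator_le_norm_self _ _)

/-- Duhamel's principle: the response to `G` is the superposition, with weight `g = G'`, of delayed
responses to the Heaviside step. A further delay `c ≥ 0` shifts the response. -/
theorem IsCausal.integral_stepResponse [CompleteSpace V] (hG : IsCausal G) (hg : IsCausal g)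
    (hGg : ∀ s, HasDerivAt G (g s) s) (hgc : Continuous g) (hz : Continuous z.uncurry)
    (x σ : ℝ) {c : ℝ} (hc : 0 ≤ c) :
    ∫ s in (0 : ℝ)..σ, stepResponse z x (s - c) (g (σ - s)) = _root_.response z G x (σ - c) := by
  have hk : Continuous (z x) := hz.comp (by fun_prop : Continuous fun s => (x, s))
  have hGc : Continuous G := continuous_iff_continuousAt.2 fun s => (hGg s).continuousAt
  rcases le_total σ c with hσ | hσ
  · rw [hG.response x _ (by linarith)]
    refine intervalIntegral.integral_zero_ae (ae_of_all _ fun s _ => ?_)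
    rcases lt_or_ge s σ with h | h
    · rw [stepResponse_of_neg (by linarith), zero_apply]
    · rw [hg _ (by linarith), map_zero]
  set τ := σ - c with hτ
  have hτ0 : 0 ≤ τ := by linarith
  have hshift := intervalIntegral.integral_comp_sub_right (a := 0) (b := σ)
    (fun s => stepResponse z x s (g (τ - s))) c
  simp only [show ∀ s, τ - (s - c) = σ - s from fun s => by rw [hτ]; ring, zero_sub] at hshift
  set P : ℝ → V →L[ℝ] V := fun s => 1 + ∫ r in (0 : ℝ)..s, z x r with hP
  have hPd : ∀ s, HasDerivAt P (z x s) s := fun s =>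
    (intervalIntegral.integral_hasDerivAt_right (hk.intervalIntegrable _ _)
      (hk.stronglyMeasurableAtFilter _ _) hk.continuousAt).const_add 1
  have hPc : Continuous P := continuous_iff_continuousAt.2 fun s => (hPd s).continuousAt
  have hcongr : EqOn (fun s => P s (g (τ - s))) (fun s => stepResponse z x s (g (τ - s)))
      (uIcc 0 τ) := fun s hs => by
    rw [uIcc_of_le hτ0] at hs
    simp only [stepResponse_of_nonneg hs.1, hP]
  have hneg : ∀ᵐ s, s ∈ uIoc (-c) 0 → stepResponse z x s (g (τ - s)) = 0 := by
    filter_upwards [compl_mem_ae_iff.2 (measure_singleton (0 : ℝ))] with s hs0 hs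
    rw [uIoc_of_le (by linarith)] at hs
    rw [stepResponse_of_neg (lt_of_le_of_ne hs.2 hs0), zero_apply]
  have hcont : Continuous fun s => P s (g (τ - s)) := hPc.clm_apply (by fun_prop)
  have hi1 : IntervalIntegrable (fun s => stepResponse z x s (g (τ - s))) volume (-c) 0 := by
    refine (intervalIntegrable_const (c := (0 : V))).congr_ae ?_
    rw [EventuallyEq, ae_restrict_iff' measurableSet_uIoc]
    exact hneg.mono fun s h hs => (h hs).symm
  have hi2 : IntervalIntegrable (fun s => stepResponse z x s (g (τ - s))) volume 0 τ :=
    (hcont.intervalIntegrable 0 τ).congr (hcongr.mono uIoc_subset_uIcc)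
  have hzG : Continuous fun s => z x s (G (τ - s)) := hk.clm_apply (by fun_prop)
  have hparts := intervalIntegral.integral_eq_sub_of_hasDerivAt (a := 0) (b := τ)
    (f := fun s => P s (G (τ - s))) (f' := fun s => z x s (G (τ - s)) + P s (-(g (τ - s))))
    (fun s _ => (hPd s).clm_apply ((hGg (τ - s)).comp_const_sub τ s))
    ((hzG.add (hPc.clm_apply (by fun_prop))).intervalIntegrable _ _)
  have hP0 : P 0 = 1 := by simp [hP]
  simp only [map_neg, ← sub_eq_add_neg] at hparts
  rw [intervalIntegral.integral_sub (hzG.intervalIntegrable _ _) (hcont.intervalIntegrable _ _),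
    sub_self, hG 0 le_rfl, map_zero, sub_zero, hP0, one_apply_eq_self] at hparts
  rw [hshift, ← intervalIntegral.integral_add_adjacent_intervals hi1 hi2,
    intervalIntegral.integral_zero_ae hneg, zero_add,
    ← intervalIntegral.integral_congr hcongr, _root_.response, add_comm,
    ← sub_eq_iff_eq_add', ← neg_sub, hparts, zero_sub, neg_neg]

end Response

/-! ### The integral equation of the wave -/

section WaveEquation

variable {V : Type*} [NormedAddCommGroup V] [NormedSpace ℝ V] {q : ℝ → V →L[ℝ] V}
  {z : ℝ → ℝ → V →L[ℝ] V}

/-- The effect at `x` of a source at `y` that is switched on at the boundary by a Heaviside step: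
the difference of the step response at `y` for the two ends of the time section of the
characteristic rectangle. -/
noncomputable def stepDifference (z : ℝ → ℝ → V →L[ℝ] V) (x y σ : ℝ) : V →L[ℝ] V :=
  stepResponse z y (σ - 2 * max (y - x) 0) - stepResponse z y (σ - 2 * y)

theorem stronglyMeasurable_stepDifference (hz : Continuous z.uncurry) (x : ℝ) :
    StronglyMeasurable (stepDifference z x).uncurry :=
  ((stronglyMeasurable_stepResponse hz).comp_measurable (by fun_prop :
      Measurable fun p : ℝ × ℝ => (p.1, p.2 - 2 * max (p.1 - x) 0))).sub
    ((stronglyMeasurable_stepResponse hz).comp_measurable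
      (by fun_prop : Measurable fun p : ℝ × ℝ => (p.1, p.2 - 2 * p.1)))

theorem exists_norm_stepDifference_le (hz : Continuous z.uncurry) (x Y σ : ℝ) :
    ∃ C, 0 ≤ C ∧ ∀ y ∈ uIcc 0 Y, ∀ s ∈ uIcc 0 σ, ‖stepDifference z x y s‖ ≤ C := by
  have hcont : Continuous fun p : ℝ × ℝ =>
      (‖(1 : V →L[ℝ] V)‖ + ‖causalPrim z p.1 (p.2 - 2 * max (p.1 - x) 0)‖)
        + (‖(1 : V →L[ℝ] V)‖ + ‖causalPrim z p.1 (p.2 - 2 * p.1)‖) :=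
    (continuous_const.add (continuous_causalPrim_comp hz (by fun_prop) (by fun_prop)).norm).add
      (continuous_const.add (continuous_causalPrim_comp hz (by fun_prop) (by fun_prop)).norm)
  obtain ⟨C, hC⟩ := ((isCompact_uIcc (a := 0) (b := Y)).prod
    (isCompact_uIcc (a := 0) (b := σ))).exists_bound_of_continuousOn hcont.continuousOn
  refine ⟨C, (norm_nonneg _).trans (hC (0, 0) ⟨left_mem_uIcc, left_mem_uIcc⟩),
    fun y hy s hs => (norm_sub_le _ _).trans (le_trans ?_
      ((le_abs_self _).trans (hC (y, s) ⟨hy, hs⟩)))⟩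
  exact add_le_add (norm_stepResponse_le _ _) (norm_stepResponse_le _ _)

/-- The kernel in terms of the step response: the Heaviside part of the step response accounts for
the Goursat data. -/
theorem IsVolterraSolution.eq_integral_stepResponse (h : IsVolterraSolution q z)
    (hq : LocallyIntegrable q volume) (hz : Continuous z.uncurry) {x σ Y : ℝ} (hx : 0 ≤ x)
    (hσ : 0 ≤ σ) (hY : x + σ / 2 ≤ Y) :
    z x σ = -((1 / 2 : ℝ) • ∫ y in (0 : ℝ)..Y,
      q y * stepDifference z x y σ) := by
  have hY0 : 0 ≤ Y := by linarith
  have hqi := hq.intervalIntegrable_real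
  have hcp : ∀ c d, IntervalIntegrable (fun y =>
      q y * (causalPrim z y (σ - 2 * max (y - x) 0) - causalPrim z y (σ - 2 * y))) volume c d :=
    intervalIntegrable_bilin (ContinuousLinearMap.mul ℝ (V →L[ℝ] V)) hq
      ((continuous_causalPrim_comp hz (by fun_prop) (by fun_prop)).sub
      (continuous_causalPrim_comp hz (by fun_prop) (by fun_prop)))
  have hpt : ∀ y, q y * stepDifference z x y σ
      = (Ioc (σ / 2) (x + σ / 2)).indicator q y
        + q y * (causalPrim z y (σ - 2 * max (y - x) 0) - causalPrim z y (σ - 2 * y)) := by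
    intro y
    have hmem : y ≤ x + σ / 2 ↔ 0 ≤ σ - 2 * max (y - x) 0 := by
      rcases le_total (y - x) 0 with h | h
      · rw [max_eq_right h]; constructor <;> intro <;> linarith
      · rw [max_eq_left h]; constructor <;> intro <;> linarith
    have hmem' : y ≤ σ / 2 ↔ 0 ≤ σ - 2 * y := by constructor <;> intro <;> linarith
    have hind : (Ioc (σ / 2) (x + σ / 2)).indicator q y
        = q y * ((Ici (0 : ℝ)).indicator (fun _ => 1) (σ - 2 * max (y - x) 0)
          - (Ici (0 : ℝ)).indicator (fun _ => 1) (σ - 2 * y)) := by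
      classical
      simp only [indicator_apply, mem_Ioc, mem_Ici, ← hmem, ← hmem', ← not_le]
      by_cases h1 : y ≤ σ / 2
      · have h2 : y ≤ x + σ / 2 := by linarith
        simp [h1, h2]
      · by_cases h2 : y ≤ x + σ / 2 <;> simp [h1, h2]
    rw [hind, ← mul_add, stepDifference, stepResponse, stepResponse]
    congr 1
    abel
  have hi1 : IntervalIntegrable (fun y => (Ioc (σ / 2) (x + σ / 2)).indicator q y) volume 0 Y := by
    rw [intervalIntegrable_iff]
    exact (hqi _ _).def'.indicator measurableSet_Ioc
  have hdata : ∫ y in (0 : ℝ)..Y, (Ioc (σ / 2) (x + σ / 2)).indicator q y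
      = ∫ y in (σ / 2)..(x + σ / 2), q y := by
    rw [intervalIntegral.integral_of_le hY0, setIntegral_indicator measurableSet_Ioc,
      Ioc_inter_Ioc, max_eq_right (by positivity), min_eq_right hY,
      ← intervalIntegral.integral_of_le (by linarith)]
  have htail : ∫ y in (x + σ / 2)..Y,
      q y * (causalPrim z y (σ - 2 * max (y - x) 0) - causalPrim z y (σ - 2 * y)) = 0 := by
    refine intervalIntegral.integral_zero_ae (ae_of_all _ fun y hy => ?_)
    rw [uIoc_of_le hY] at hy
    have hmax := le_max_left (y - x) 0
    rw [causalPrim_of_nonpos (by linarith [hy.1]), causalPrim_of_nonpos (by linarith [hy.1]),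
      sub_zero, mul_zero]
  simp only [hpt]
  rw [intervalIntegral.integral_add hi1 (hcp _ _), hdata,
    ← intervalIntegral.integral_add_adjacent_intervals (hcp 0 (x + σ / 2)) (hcp _ _), htail,
    add_zero, smul_add, neg_add, h x σ hx hσ]
  rfl

theorem intervalIntegrable_stepResponse_apply (hz : Continuous z.uncurry) {g : ℝ → V}
    (hgc : Continuous g) (y c σ : ℝ) :
    IntervalIntegrable (fun s => stepResponse z y (s - c) (g (σ - s))) volume 0 σ := by
  have hcp : Continuous fun s => causalPrim z y (s - c) :=
    continuous_causalPrim_comp hz (by fun_prop) (by fun_prop)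
  have h1 : IntervalIntegrable (fun s => (Ici c).indicator (fun s => g (σ - s)) s) volume 0 σ := by
    rw [intervalIntegrable_iff]
    exact (Continuous.intervalIntegrable (by fun_prop) _ _).def'.indicator measurableSet_Ici
  refine (h1.add ((hcp.clm_apply (by fun_prop :
    Continuous fun s => g (σ - s))).intervalIntegrable 0 σ)).congr fun s _ => ?_
  classical
  simp only [stepResponse, indicator_apply, mem_Ici, sub_nonneg]
  split_ifs <;> simp

theorem intervalIntegrable_mul_stepDifference (hq : LocallyIntegrable q volume)
    (hz : Continuous z.uncurry) (x Y s : ℝ) :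
    IntervalIntegrable (fun y => q y * stepDifference z x y s) volume 0 Y := by
  obtain ⟨C, -, hC⟩ := exists_norm_stepDifference_le hz x Y s
  exact intervalIntegrable_mul_of_bounded hq
    ((stronglyMeasurable_stepDifference hz x).comp_measurable
      (by fun_prop : Measurable fun y : ℝ => (y, s))) fun y hy => hC y hy s right_mem_uIcc

theorem integral_apply_stepDifference [CompleteSpace V] (hz : Continuous z.uncurry) {g G : ℝ → V}
    (hG : IsCausal G) (hg : IsCausal g) (hGg : ∀ s, HasDerivAt G (g s) s) (hgc : Continuous g)
    (T : V →L[ℝ] V) (x σ : ℝ) {y : ℝ} (hy : 0 ≤ y) :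
    ∫ s in (0 : ℝ)..σ, T (stepDifference z x y s (g (σ - s)))
      = T (response z G y (σ - 2 * max (y - x) 0) - response z G y (σ - 2 * y)) := by
  have hm := intervalIntegrable_stepResponse_apply hz hgc y
  have hcongr : ∀ s, stepDifference z x y s (g (σ - s))
      = stepResponse z y (s - 2 * max (y - x) 0) (g (σ - s))
        - stepResponse z y (s - 2 * y) (g (σ - s)) := fun s => rfl
  simp only [hcongr]
  rw [T.intervalIntegral_comp_comm ((hm _ σ).sub (hm _ σ)),
    intervalIntegral.integral_sub (hm _ _) (hm _ _),
    hG.integral_stepResponse hg hGg hgc hz y σ (by positivity),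
    hG.integral_stepResponse hg hGg hgc hz y σ (by linarith)]

/-- D'Alembert's formula for `u_tt - u_xx = -q u` with the boundary signal `g`: the response solves
an integral equation in which the integration over time has been carried out, so that the signal
`g` is replaced by its primitive `G` under the integral. -/
theorem IsVolterraSolution.response_eq [CompleteSpace V] (h : IsVolterraSolution q z)
    (hq : LocallyIntegrable q volume) (hz : Continuous z.uncurry) {g G : ℝ → V} (hG : IsCausal G)
    (hg : IsCausal g) (hGg : ∀ s, HasDerivAt G (g s) s) (hgc : Continuous g) {x σ Y : ℝ}
    (hx : 0 ≤ x) (hσ : 0 ≤ σ) (hY : x + σ / 2 ≤ Y) :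
    response z g x σ = g σ - (1 / 2 : ℝ) • ∫ y in (0 : ℝ)..Y,
      q y (response z G y (σ - 2 * max (y - x) 0) - response z G y (σ - 2 * y)) := by
  have hY0 : 0 ≤ Y := by linarith
  have hS := stronglyMeasurable_stepDifference hz x
  obtain ⟨C, hC0, hC⟩ := exists_norm_stepDifference_le hz x Y σ
  obtain ⟨C', hC'⟩ := (isCompact_uIcc (a := 0) (b := σ)).exists_bound_of_continuousOn
    (f := fun s => g (σ - s)) (by fun_prop)
  have hK : StronglyMeasurable (Function.uncurry fun y s => stepDifference z x y s (g (σ - s))) :=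
    isBoundedBilinearMap_apply.continuous.comp_stronglyMeasurable
      (hS.prodMk (by fun_prop : Continuous fun p : ℝ × ℝ => g (σ - p.2)).stronglyMeasurable)
  have hswap := intervalIntegral_bilin_swap (ContinuousLinearMap.id ℝ (V →L[ℝ] V)) hq hK
    (a := 0) (b := Y) (c := 0) (d := σ) (C := C * C') (fun y hy s hs =>
      (ContinuousLinearMap.le_opNorm _ _).trans
        (mul_le_mul (hC y hy s hs) (hC' s hs) (norm_nonneg _) hC0))
  simp only [ContinuousLinearMap.id_apply] at hswap
  have hinner : ∀ s ∈ uIcc 0 σ, z x s (g (σ - s))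
      = -((1 / 2 : ℝ) • ∫ y in (0 : ℝ)..Y, q y (stepDifference z x y s (g (σ - s)))) := by
    intro s hs
    have hs' := hs
    rw [uIcc_of_le hσ] at hs'
    rw [h.eq_integral_stepResponse hq hz hx hs'.1 (Y := Y) (by linarith [hs'.2])]
    have := ContinuousLinearMap.intervalIntegral_apply
      (intervalIntegrable_mul_stepDifference hq hz x Y s) (g (σ - s))
    simp only [mul_apply_eq_comp] at this
    rw [← this]
    rfl
  have hsy : ∀ y ∈ uIcc 0 Y, ∫ s in (0 : ℝ)..σ, q y (stepDifference z x y s (g (σ - s)))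
      = q y (response z G y (σ - 2 * max (y - x) 0) - response z G y (σ - 2 * y)) := by
    intro y hy
    rw [uIcc_of_le hY0] at hy
    exact integral_apply_stepDifference hz hG hg hGg hgc (q y) x σ hy.1
  rw [response, intervalIntegral.integral_congr hinner, intervalIntegral.integral_neg,
    intervalIntegral.integral_smul, ← hswap, intervalIntegral.integral_congr hsy, sub_eq_add_neg]

end WaveEquation

/-! ### Twofold integration in the space variable -/

section Taylor

variable {V : Type*} [NormedAddCommGroup V] [NormedSpace ℝ V] [CompleteSpace V]
  {ψ ψ₁ ψ₂ : ℝ → V}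

theorem integral_sub_smul_comp_add (h₁ : ∀ s, HasDerivAt ψ (ψ₁ s) s)
    (h₂ : ∀ s, HasDerivAt ψ₁ (ψ₂ s) s) (hc : Continuous ψ₂) (a x c d : ℝ) :
    ∫ r in c..d, (x - r) • ψ₂ (a + r)
      = (x - d) • ψ₁ (a + d) + ψ (a + d) - ((x - c) • ψ₁ (a + c) + ψ (a + c)) := by
  refine intervalIntegral.integral_eq_sub_of_hasDerivAt
    (f := fun r => (x - r) • ψ₁ (a + r) + ψ (a + r)) (fun r _ => ?_)
    (Continuous.intervalIntegrable (by fun_prop) _ _)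
  have := (((hasDerivAt_id r).const_sub x).smul ((h₂ (a + r)).comp_const_add a r)).add
    ((h₁ (a + r)).comp_const_add a r)
  exact this.congr_deriv (by simp only [id_eq]; module)

theorem integral_sub_smul_comp_sub (h₁ : ∀ s, HasDerivAt ψ (ψ₁ s) s)
    (h₂ : ∀ s, HasDerivAt ψ₁ (ψ₂ s) s) (hc : Continuous ψ₂) (a x c d : ℝ) :
    ∫ r in c..d, (x - r) • ψ₂ (a - r)
      = ψ (a - d) - (x - d) • ψ₁ (a - d) - (ψ (a - c) - (x - c) • ψ₁ (a - c)) := by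
  refine intervalIntegral.integral_eq_sub_of_hasDerivAt
    (f := fun r => ψ (a - r) - (x - r) • ψ₁ (a - r)) (fun r _ => ?_)
    (Continuous.intervalIntegrable (by fun_prop) _ _)
  have := ((h₁ (a - r)).comp_const_sub a r).sub
    (((hasDerivAt_id r).const_sub x).smul ((h₂ (a - r)).comp_const_sub a r))
  exact this.congr_deriv (by simp only [id_eq]; module)

theorem taylor_comp_sub (h₁ : ∀ s, HasDerivAt ψ (ψ₁ s) s)
    (h₂ : ∀ s, HasDerivAt ψ₁ (ψ₂ s) s) (hc : Continuous ψ₂) (a x : ℝ) :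
    ψ (a - x) = ψ a - x • ψ₁ a + ∫ r in (0 : ℝ)..x, (x - r) • ψ₂ (a - r) := by
  rw [integral_sub_smul_comp_sub h₁ h₂ hc]
  simp

/-- Taylor's formula along the broken characteristic `x ↦ t - x - 2 (y - x)₊`, whose corner at
`x = y` contributes the term with `(x - y)₊`. -/
theorem taylor_comp_broken_line (h₁ : ∀ s, HasDerivAt ψ (ψ₁ s) s)
    (h₂ : ∀ s, HasDerivAt ψ₁ (ψ₂ s) s) (hc : Continuous ψ₂) (t : ℝ) {x y : ℝ} (hx : 0 ≤ x)
    (hy : 0 ≤ y) :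
    ψ (t - x - 2 * max (y - x) 0) = ψ (t - 2 * y) + x • ψ₁ (t - 2 * y)
      - (2 * max (x - y) 0) • ψ₁ (t - y)
      + ∫ r in (0 : ℝ)..x, (x - r) • ψ₂ (t - r - 2 * max (y - r) 0) := by
  have hl : ∀ c d, 0 ≤ c → c ≤ d → d ≤ y →
      ∫ r in c..d, (x - r) • ψ₂ (t - r - 2 * max (y - r) 0)
        = ∫ r in c..d, (x - r) • ψ₂ (t - 2 * y + r) := by
    intro c d _ hcd hd
    refine intervalIntegral.integral_congr fun r hr => ?_
    rw [uIcc_of_le hcd] at hr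
    simp only [max_eq_left (show 0 ≤ y - r by linarith [hr.2])]
    congr 2; ring
  rcases le_total x y with hxy | hxy
  · rw [hl 0 x le_rfl hx hxy, integral_sub_smul_comp_add h₁ h₂ hc, max_eq_left (by linarith),
      max_eq_right (a := x - y) (by linarith),
      show t - x - 2 * (y - x) = t - 2 * y + x by ring]
    simp only [mul_zero, zero_smul, sub_self, sub_zero, add_zero, zero_add]
    abel
  · have hr : ∫ r in y..x, (x - r) • ψ₂ (t - r - 2 * max (y - r) 0)
        = ∫ r in y..x, (x - r) • ψ₂ (t - r) := by
      refine intervalIntegral.integral_congr fun r hr => ?_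
      rw [uIcc_of_le hxy] at hr
      simp only [max_eq_right (show y - r ≤ 0 by linarith [hr.1]), mul_zero, sub_zero]
    have hi : Continuous fun r => (x - r) • ψ₂ (t - r - 2 * max (y - r) 0) := by fun_prop
    rw [← intervalIntegral.integral_add_adjacent_intervals (hi.intervalIntegrable 0 y)
      (hi.intervalIntegrable y x), hl 0 y le_rfl hy le_rfl, hr,
      integral_sub_smul_comp_add h₁ h₂ hc, integral_sub_smul_comp_sub h₁ h₂ hc,
      max_eq_right (by linarith), max_eq_left (by linarith),
      show t - 2 * y + y = t - y by ring]
    simp only [mul_zero, sub_zero, add_zero, sub_self, zero_smul]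
    module

end Taylor

section SecondOrder

variable {V : Type*} [NormedAddCommGroup V] [NormedSpace ℝ V] [CompleteSpace V]
  {q : ℝ → V →L[ℝ] V} {z : ℝ → ℝ → V →L[ℝ] V}

/-- At a fixed time `t` the wave `x ↦ response z g₀ x (t - x)` is, up to an affine function, the
twofold primitive of `u_tt + q u`: it satisfies `u_xx = u_tt + q u` in the integrated sense. -/
theorem IsVolterraSolution.response_eq_twofold_primitive (h : IsVolterraSolution q z)
    (hq : LocallyIntegrable q volume) (hz : Continuous z.uncurry) {G g₀ g₁ g₂ : ℝ → V}
    (hG : IsCausal G) (hg₀ : IsCausal g₀) (hg₁ : IsCausal g₁) (hg₂ : IsCausal g₂)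
    (hG' : ∀ s, HasDerivAt G (g₀ s) s) (hg₀' : ∀ s, HasDerivAt g₀ (g₁ s) s)
    (hg₁' : ∀ s, HasDerivAt g₁ (g₂ s) s) (hc₂ : Continuous g₂) (t : ℝ) :
    ∃ c : V, ∀ x, 0 ≤ x → x ≤ t → response z g₀ x (t - x) = g₀ t + x • c
      + ∫ r in (0 : ℝ)..x,
          (x - r) • (response z g₂ r (t - r) + q r (response z g₀ r (t - r))) := by
  have hc₁ : Continuous g₁ := continuous_iff_continuousAt.2 fun s => (hg₁' s).continuousAt
  have hc₀ : Continuous g₀ := continuous_iff_continuousAt.2 fun s => (hg₀' s).continuousAt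
  have hint : ∀ k : ℝ → V, Continuous k → ∀ a b,
      IntervalIntegrable (fun y => q y (k y)) volume a b := fun k hk a b =>
    intervalIntegrable_bilin (ContinuousLinearMap.id ℝ (V →L[ℝ] V)) hq hk a b
  refine ⟨-g₁ t - ∫ y in (0 : ℝ)..t, q y (response z g₀ y (t - 2 * y)), fun x hx hxt => ?_⟩
  have ht : 0 ≤ t := hx.trans hxt
  have hψ₁ := fun y s => hG.hasDerivAt_response hg₀ hG' hc₀ hz y s
  have hψ₂ := fun y s => hg₀.hasDerivAt_response hg₁ hg₀' hc₁ hz y s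
  have hcψ : ∀ y, Continuous (response z g₁ y) := fun y =>
    continuous_response_comp hz hc₁ continuous_const continuous_id
  -- `K y r` is the integrand of the integral equation for the second time derivative.
  set K : ℝ → ℝ → V := fun y r =>
    response z g₁ y (t - r - 2 * max (y - r) 0) - response z g₁ y (t - r - 2 * y) with hK
  have hKc : Continuous K.uncurry :=
    (continuous_response_comp hz hc₁ (by fun_prop) (by fun_prop)).sub
      (continuous_response_comp hz hc₁ (by fun_prop) (by fun_prop))
  have hpt : ∀ y ∈ uIcc 0 t,
      q y (response z G y (t - x - 2 * max (y - x) 0) - response z G y (t - x - 2 * y))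
        = (2 * x) • q y (response z g₀ y (t - 2 * y))
          - (2 : ℝ) • q y (max (x - y) 0 • response z g₀ y (t - y))
          + ∫ r in (0 : ℝ)..x, q y ((x - r) • K y r) := by
    intro y hy
    rw [uIcc_of_le ht] at hy
    have hi1 : IntervalIntegrable (fun r => (x - r) • response z g₁ y (t - r - 2 * max (y - r) 0))
        volume 0 x := Continuous.intervalIntegrable (by fun_prop) _ _
    have hi2 : IntervalIntegrable (fun r => (x - r) • response z g₁ y (t - r - 2 * y))
        volume 0 x := Continuous.intervalIntegrable (by fun_prop) _ _
    have e1 := taylor_comp_broken_line (hψ₁ y) (hψ₂ y) (hcψ y) t hx hy.1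
    have e2 := taylor_comp_sub (hψ₁ y) (hψ₂ y) (hcψ y) (t - 2 * y) x
    rw [show t - 2 * y - x = t - x - 2 * y by ring] at e2
    have e3 : ∫ r in (0 : ℝ)..x, q y ((x - r) • K y r)
        = q y ((∫ r in (0 : ℝ)..x, (x - r) • response z g₁ y (t - r - 2 * max (y - r) 0))
          - ∫ r in (0 : ℝ)..x, (x - r) • response z g₁ y (t - 2 * y - r)) := by
      have : ∀ r, t - 2 * y - r = t - r - 2 * y := fun r => by ring
      simp only [this]
      rw [← intervalIntegral.integral_sub hi1 hi2, ← (q y).intervalIntegral_comp_comm (hi1.sub hi2)]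
      simp only [hK, smul_sub]
    rw [e3, e1, e2]
    simp only [map_add, map_sub, map_smul]
    module
  have hI1 : IntervalIntegrable (fun y => q y (response z g₀ y (t - 2 * y))) volume 0 t :=
    hint _ (continuous_response_comp hz hc₀ (by fun_prop) (by fun_prop)) _ _
  have hI2 : ∀ a b, IntervalIntegrable
      (fun y => q y (max (x - y) 0 • response z g₀ y (t - y))) volume a b :=
    hint _ ((by fun_prop : Continuous fun y => max (x - y) 0).smul
      (continuous_response_comp hz hc₀ (by fun_prop) (by fun_prop)))
  have hK2 : Continuous (Function.uncurry fun y r => (x - r) • K y r) :=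
    (by fun_prop : Continuous fun p : ℝ × ℝ => x - p.2).smul hKc
  have hI3 : IntervalIntegrable (fun y => ∫ r in (0 : ℝ)..x, q y ((x - r) • K y r))
      volume 0 t := by
    have := hint (fun y => ∫ r in (0 : ℝ)..x, (x - r) • K y r)
      (intervalIntegral.continuous_parametric_intervalIntegral_of_continuous' hK2 0 x) 0 t
    refine this.congr fun y _ => ?_
    exact ((q y).intervalIntegral_comp_comm (Continuous.intervalIntegrable
      (hK2.comp (by fun_prop : Continuous fun r => (y, r))) _ _)).symm
  have hswap := intervalIntegral_bilin_swap_of_continuous (ContinuousLinearMap.id ℝ (V →L[ℝ] V)) hq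
    hK2 0 t 0 x
  simp only [ContinuousLinearMap.id_apply] at hswap
  -- The integral equation for the second time derivative.
  have htt : ∀ r ∈ uIcc 0 x, ∫ y in (0 : ℝ)..t, q y ((x - r) • K y r)
      = (2 : ℝ) • ((x - r) • g₂ (t - r) - (x - r) • response z g₂ r (t - r)) := by
    intro r hr
    rw [uIcc_of_le hx] at hr
    have e := h.response_eq hq hz hg₁ hg₂ hg₁' hc₂ (x := r) (σ := t - r) (Y := t) hr.1
      (by linarith [hr.2]) (by linarith [hr.2])
    simp only [map_smul, intervalIntegral.integral_smul]
    rw [e]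
    module
  have hcorner : ∫ y in (0 : ℝ)..t, q y (max (x - y) 0 • response z g₀ y (t - y))
      = ∫ y in (0 : ℝ)..x, (x - y) • q y (response z g₀ y (t - y)) := by
    rw [← intervalIntegral.integral_add_adjacent_intervals (hI2 0 x) (hI2 x t)]
    have h1 : ∫ y in x..t, q y (max (x - y) 0 • response z g₀ y (t - y)) = 0 := by
      refine intervalIntegral.integral_zero_ae (ae_of_all _ fun y hy => ?_)
      rw [uIoc_of_le hxt] at hy
      rw [max_eq_right (by linarith [hy.1]), zero_smul, map_zero]
    rw [h1, add_zero]
    refine intervalIntegral.integral_congr fun y hy => ?_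
    rw [uIcc_of_le hx] at hy
    simp only [max_eq_left (show 0 ≤ x - y by linarith [hy.2]), map_smul]
  have hu := h.response_eq hq hz hG hg₀ hG' hc₀ (x := x) (σ := t - x) (Y := t) hx
    (by linarith) (by linarith)
  have hC1 : IntervalIntegrable (fun r => (x - r) • g₂ (t - r)) volume 0 x :=
    Continuous.intervalIntegrable (by fun_prop) _ _
  have hC2 : IntervalIntegrable (fun r => (x - r) • response z g₂ r (t - r)) volume 0 x :=
    Continuous.intervalIntegrable ((by fun_prop : Continuous fun r => x - r).smul
      (continuous_response_comp hz hc₂ (by fun_prop) (by fun_prop))) _ _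
  have hC3 : IntervalIntegrable (fun r => (x - r) • q r (response z g₀ r (t - r))) volume 0 x := by
    have := hint (fun r => (x - r) • response z g₀ r (t - r))
      ((by fun_prop : Continuous fun r => x - r).smul
        (continuous_response_comp hz hc₀ (by fun_prop) (by fun_prop))) 0 x
    simpa only [map_smul] using this
  have hI1' : IntervalIntegrable (fun y => (2 * x) • q y (response z g₀ y (t - 2 * y)))
      volume 0 t := hI1.smul (2 * x)
  have hI2' : IntervalIntegrable
      (fun y => (2 : ℝ) • q y (max (x - y) 0 • response z g₀ y (t - y))) volume 0 t :=
    (hI2 0 t).smul (2 : ℝ)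
  rw [hu, intervalIntegral.integral_congr hpt, intervalIntegral.integral_add
    (hI1'.sub hI2') hI3, intervalIntegral.integral_sub hI1' hI2',
    intervalIntegral.integral_smul, intervalIntegral.integral_smul, hcorner, hswap,
    intervalIntegral.integral_congr htt, intervalIntegral.integral_smul,
    intervalIntegral.integral_sub hC1 hC2, taylor_comp_sub hg₀' hg₁' hc₂ t x]
  simp only [smul_add]
  rw [intervalIntegral.integral_add hC2 hC3]
  module

end SecondOrder

/-! ### Primitives as Sobolev functions -/

section Primitive

variable {V : Type*} [NormedAddCommGroup V] [NormedSpace ℝ V]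

theorem locallyIntegrable_of_intervalIntegrable {E : Type*} [NormedAddCommGroup E] {h : ℝ → E}
    (hh : ∀ a b, IntervalIntegrable h volume a b) : LocallyIntegrable h volume := fun x =>
  ⟨Ioc (x - 1) (x + 1), Ioc_mem_nhds (by linarith) (by linarith), (hh (x - 1) (x + 1)).1⟩

theorem integral_smul_primitive [CompleteSpace V] {h : ℝ → V}
    (hh : LocallyIntegrable h volume) {k : ℝ → ℝ} (hk : Continuous k) {b : ℝ} (hb : 0 ≤ b) :
    ∫ x in (0 : ℝ)..b, k x • ∫ r in (0 : ℝ)..x, h r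
      = ∫ r in (0 : ℝ)..b, (∫ x in r..b, k x) • h r := by
  have hS : MeasurableSet {p : ℝ × ℝ | p.1 < p.2} := measurableSet_lt measurable_fst measurable_snd
  have hK : StronglyMeasurable (Function.uncurry fun r x => (Ioi r).indicator k x) :=
    ((hk.comp continuous_snd).stronglyMeasurable).indicator hS
  obtain ⟨C, hC⟩ := (isCompact_uIcc (a := 0) (b := b)).exists_bound_of_continuousOn hk.continuousOn
  have hswap := intervalIntegral_bilin_swap (ContinuousLinearMap.lsmul ℝ ℝ (E := V)).flip hh hK
    (a := 0) (b := b) (c := 0) (d := b)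
    (fun r _ x hx => (norm_indicator_le_norm_self _ _).trans (hC x hx))
  simp only [ContinuousLinearMap.flip_apply, ContinuousLinearMap.lsmul_apply] at hswap
  have h1 : ∀ x ∈ uIcc 0 b, ∫ r in (0 : ℝ)..b, (Ioi r).indicator k x • h r
      = k x • ∫ r in (0 : ℝ)..x, h r := by
    intro x hx
    rw [uIcc_of_le hb] at hx
    have : ∀ r, (Ioi r).indicator k x • h r = (Iio x).indicator (fun r => k x • h r) r := by
      classical
      intro r
      simp only [indicator_apply, mem_Ioi, mem_Iio]
      split_ifs <;> simp
    simp only [this]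
    have hset : Ioc 0 b ∩ Iio x = Ioo 0 x := by
      ext r
      exact ⟨fun h => ⟨h.1.1, h.2⟩, fun h => ⟨⟨h.1, h.2.le.trans hx.2⟩, h.2⟩⟩
    rw [intervalIntegral.integral_of_le hb, setIntegral_indicator measurableSet_Iio, hset,
      ← integral_Ioc_eq_integral_Ioo, ← intervalIntegral.integral_of_le hx.1,
      intervalIntegral.integral_smul]
  have h2 : ∀ r ∈ uIcc 0 b, ∫ x in (0 : ℝ)..b, (Ioi r).indicator k x • h r
      = (∫ x in r..b, k x) • h r := by
    intro r hr
    rw [uIcc_of_le hb] at hr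
    have hi : IntervalIntegrable (fun x => (Ioi r).indicator k x) volume 0 b := by
      rw [intervalIntegrable_iff]
      exact (hk.intervalIntegrable _ _).def'.indicator measurableSet_Ioi
    have : ∫ x in (0 : ℝ)..b, (Ioi r).indicator k x • h r
        = (∫ x in (0 : ℝ)..b, (Ioi r).indicator k x) • h r :=
      intervalIntegral.integral_smul_const _ _
    rw [this, intervalIntegral.integral_of_le hb, setIntegral_indicator measurableSet_Ioi,
      Ioc_inter_Ioi, max_eq_right hr.1, ← intervalIntegral.integral_of_le hr.2]
  rw [← intervalIntegral.integral_congr h1, ← hswap, intervalIntegral.integral_congr h2]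

theorem integral_sub_smul_eq_twofold_primitive [CompleteSpace V] {h : ℝ → V}
    (hh : LocallyIntegrable h volume) {x : ℝ} (hx : 0 ≤ x) :
    ∫ r in (0 : ℝ)..x, (x - r) • h r = ∫ s in (0 : ℝ)..x, ∫ r in (0 : ℝ)..s, h r := by
  have := integral_smul_primitive hh (k := fun _ => 1) continuous_const hx
  simpa using this.symm

theorem continuous_primitive_of_locallyIntegrable {h : ℝ → V} (hh : LocallyIntegrable h volume) :
    Continuous fun x => ∫ r in (0 : ℝ)..x, h r :=
  intervalIntegral.continuous_primitive (fun a b => hh.intervalIntegrable_real a b) 0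

end Primitive

section Sobolev

variable {n : ℕ}

/-- An absolutely continuous function is a Sobolev function with the expected weak derivative. -/
theorem hasWeakDerivL1_of_eq_primitive {t : ℝ} (ht : 0 ≤ t) {y h : ℝ → Fin n → ℂ}
    (hh : LocallyIntegrable h volume) {c : Fin n → ℂ}
    (hy : ∀ x, 0 ≤ x → x ≤ t → y x = c + ∫ r in (0 : ℝ)..x, h r) : HasWeakDerivL1 0 t y h := by
  have hP := continuous_primitive_of_locallyIntegrable hh
  have hEq : EqOn (fun x => c + ∫ r in (0 : ℝ)..x, h r) y (Ioo 0 t) :=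
    fun x hx => (hy x hx.1.le hx.2.le).symm
  refine ⟨?_, ?_, fun φ hφ _ hsupp => ?_⟩
  · exact IntegrableOn.congr_fun (((continuous_const.add hP).integrableOn_Icc).mono_set
      Ioo_subset_Icc_self) hEq measurableSet_Ioo
  · exact ((hh.integrableOn_isCompact isCompact_Icc).mono_set Ioo_subset_Icc_self)
  have hφ0 : φ 0 = 0 := image_eq_zero_of_notMem_tsupport fun h0 => lt_irrefl _ (hsupp h0).1
  have hφt : φ t = 0 := image_eq_zero_of_notMem_tsupport fun h0 => lt_irrefl _ (hsupp h0).2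
  have hφd : ∀ x, HasDerivAt φ (deriv φ x) x := fun x =>
    (hφ.differentiable (by simp)).differentiableAt.hasDerivAt
  have hφ' : Continuous (deriv φ) := hφ.continuous_deriv (by simp)
  have hFTC : ∀ r, ∫ x in r..t, deriv φ x = -φ r := fun r => by
    rw [intervalIntegral.integral_eq_sub_of_hasDerivAt (fun x _ => hφd x)
      (hφ'.intervalIntegrable _ _), hφt, zero_sub]
  have e1 : ∫ x in Ioo 0 t, deriv φ x • y x
      = ∫ x in (0 : ℝ)..t, (deriv φ x • c + deriv φ x • ∫ r in (0 : ℝ)..x, h r) := by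
    rw [intervalIntegral.integral_of_le ht, integral_Ioc_eq_integral_Ioo]
    refine setIntegral_congr_fun measurableSet_Ioo fun x hx => ?_
    simp only [hy x hx.1.le hx.2.le, smul_add]
  rw [e1, intervalIntegral.integral_add
    (Continuous.intervalIntegrable (by fun_prop) _ _)
    ((by fun_prop : Continuous fun x => deriv φ x • ∫ r in (0 : ℝ)..x, h r).intervalIntegrable _ _),
    intervalIntegral.integral_smul_const, hFTC,
    hφ0, integral_smul_primitive hh hφ' ht]
  simp only [hFTC, neg_zero, zero_smul, zero_add, neg_smul, intervalIntegral.integral_neg]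
  rw [intervalIntegral.integral_of_le ht, integral_Ioc_eq_integral_Ioo]

/-- A twofold primitive of a summable function `h` belongs to `W²₁`, and by the Lebesgue
differentiation theorem its pointwise second derivative is `h` almost everywhere. -/
theorem hasW21Derivs_of_eq_twofold_primitive {t : ℝ} (ht : 0 ≤ t) {y h : ℝ → Fin n → ℂ}
    (hh : LocallyIntegrable h volume) {a c : Fin n → ℂ}
    (hy : ∀ x, 0 ≤ x → x ≤ t → y x = a + x • c + ∫ r in (0 : ℝ)..x, (x - r) • h r) :
    HasW21Derivs 0 t y (fun x => c + ∫ r in (0 : ℝ)..x, h r) h ∧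
      ∀ᵐ x ∂volume.restrict (Ioo 0 t), HasSecondDerivAt y (h x) x := by
  have hP := continuous_primitive_of_locallyIntegrable hh
  have hP' : Continuous fun x => c + ∫ r in (0 : ℝ)..x, h r := continuous_const.add hP
  have hy' : ∀ x, 0 ≤ x → x ≤ t → y x = a + ∫ s in (0 : ℝ)..x, (c + ∫ r in (0 : ℝ)..s, h r) := by
    intro x hx hxt
    rw [hy x hx hxt, integral_sub_smul_eq_twofold_primitive hh hx, intervalIntegral.integral_add
      intervalIntegrable_const (hP.intervalIntegrable _ _), intervalIntegral.integral_const,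
      sub_zero, add_assoc]
  refine ⟨⟨hasWeakDerivL1_of_eq_primitive ht hP'.locallyIntegrable hy',
    hasWeakDerivL1_of_eq_primitive ht hh fun x _ _ => rfl⟩, ?_⟩
  filter_upwards [ae_restrict_mem measurableSet_Ioo,
    ae_restrict_of_ae (LocallyIntegrable.ae_hasDerivAt_integral hh)] with x hx hxd
  refine ⟨fun x => c + ∫ r in (0 : ℝ)..x, h r, ?_, (hxd 0).const_add c⟩
  filter_upwards [Ioo_mem_nhds hx.1 hx.2] with s hs
  have hd : HasDerivAt (fun x => a + ∫ s in (0 : ℝ)..x, (c + ∫ r in (0 : ℝ)..s, h r))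
      (c + ∫ r in (0 : ℝ)..s, h r) s :=
    (intervalIntegral.integral_hasDerivAt_right (hP'.intervalIntegrable _ _)
      (hP'.stronglyMeasurableAtFilter _ _) hP'.continuousAt).const_add a
  refine hd.congr_of_eventuallyEq ?_
  filter_upwards [Ioo_mem_nhds hs.1 hs.2] with r hr
  exact hy' r hr.1.le hr.2.le

end Sobolev

/-! ### The Goursat kernel -/

theorem locallyIntegrable_indicator_Ici {E : Type*} [NormedAddCommGroup E] {q : ℝ → E}
    (hq : LocallyIntegrableOn q (Ici 0) volume) :
    LocallyIntegrable ((Ici (0 : ℝ)).indicator q) volume := by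
  refine locallyIntegrable_of_intervalIntegrable fun a b => ?_
  rw [intervalIntegrable_iff, IntegrableOn, integrable_indicator_iff measurableSet_Ici,
    IntegrableOn, Measure.restrict_restrict measurableSet_Ici]
  exact (hq.integrableOn_compact_subset inter_subset_left
    (isCompact_uIcc.inter_left isClosed_Ici)).mono_set
      (inter_subset_inter_right _ uIoc_subset_uIcc)

section Kernel

variable {n : ℕ} {q : ℝ → Matrix (Fin n) (Fin n) ℂ}

/-- Dictionary between the characteristic variables and the coordinates
`(x, σ) = ((η - ξ) / 2, ξ)`. -/
theorem goursat_rhs_eq (hq : LocallyIntegrableOn q (Ici 0) volume)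
    {z : ℝ → ℝ → Matrix (Fin n) (Fin n) ℂ} (hz : Continuous z.uncurry)
    {w : ℝ → ℝ → Matrix (Fin n) (Fin n) ℂ}
    (hw : ∀ x t, 0 ≤ x → x ≤ t → w x t = z x (t - x)) {ξ η : ℝ} (hξ : 0 ≤ ξ) (hη : ξ ≤ η) :
    -((1 / 2 : ℝ) • ∫ s in (ξ / 2)..(η / 2), q s)
        - (1 / 4 : ℝ) • ∫ ξ₁ in (0 : ℝ)..ξ, ∫ η₁ in ξ..η,
            q ((η₁ - ξ₁) / 2) * charVars w ξ₁ η₁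
      = goursatData ((Ici 0).indicator q) ((η - ξ) / 2) ξ
        + volterra ((Ici 0).indicator q) z ((η - ξ) / 2) ξ := by
  have hx : 0 ≤ (η - ξ) / 2 := by linarith
  rw [← integral_rectangle_eq_volterra (locallyIntegrable_indicator_Ici hq) hz hx hξ, goursatData,
    ← sub_eq_add_neg, show (η - ξ) / 2 + ξ / 2 = η / 2 by ring,
    show ξ + 2 * ((η - ξ) / 2) = η by ring]
  congr 1
  · congr 2
    refine intervalIntegral.integral_congr fun s hs => ?_
    rw [uIcc_of_le (by linarith)] at hs
    exact (indicator_of_mem (show s ∈ Ici (0 : ℝ) from (by linarith : 0 ≤ ξ / 2).trans hs.1) q).symm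
  · congr 1
    refine intervalIntegral.integral_congr fun ξ₁ h₁ => ?_
    rw [uIcc_of_le hξ] at h₁
    refine intervalIntegral.integral_congr fun η₁ h₂ => ?_
    rw [uIcc_of_le hη] at h₂
    have h0 : 0 ≤ (η₁ - ξ₁) / 2 := by linarith [h₁.2, h₂.1]
    simp only [charVars]
    rw [indicator_of_mem (show (η₁ - ξ₁) / 2 ∈ Ici (0 : ℝ) from h0),
      hw _ _ h0 (by linarith [h₁.1]), show (η₁ + ξ₁) / 2 - (η₁ - ξ₁) / 2 = ξ₁ by ring]

theorem IsVolterraSolution.isGoursatKernel (hq : LocallyIntegrableOn q (Ici 0) volume)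
    {z : ℝ → ℝ → Matrix (Fin n) (Fin n) ℂ} (hz : Continuous z.uncurry)
    (h : IsVolterraSolution ((Ici 0).indicator q) z) :
    IsGoursatKernel q (fun x t => z x (t - x)) where
  continuousOn :=
    (hz.comp (by fun_prop : Continuous fun p : ℝ × ℝ => (p.1, p.2 - p.1))).continuousOn
  integral_eq ξ η hξ hη := by
    rw [goursat_rhs_eq hq hz (fun _ _ _ _ => rfl) hξ hη, ← h _ _ (by linarith) hξ, charVars,
      show (η + ξ) / 2 - (η - ξ) / 2 = ξ by ring]

theorem IsGoursatKernel.exists_isVolterraSolution (hq : LocallyIntegrableOn q (Ici 0) volume)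
    {w : ℝ → ℝ → Matrix (Fin n) (Fin n) ℂ} (h : IsGoursatKernel q w) :
    ∃ z : ℝ → ℝ → Matrix (Fin n) (Fin n) ℂ, Continuous z.uncurry ∧
      IsVolterraSolution ((Ici 0).indicator q) z ∧
      ∀ x t, 0 ≤ x → x ≤ t → w x t = z x (t - x) := by
  have hz : Continuous (Function.uncurry fun x σ => w (max x 0) (max x 0 + max σ 0)) :=
    h.continuousOn.comp_continuous
      (by fun_prop : Continuous fun p : ℝ × ℝ => (max p.1 0, max p.1 0 + max p.2 0))
      fun p => ⟨le_max_right _ _, le_add_of_nonneg_right (le_max_right _ _)⟩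
  have hw : ∀ x t, 0 ≤ x → x ≤ t → w x t = w (max x 0) (max x 0 + max (t - x) 0) := by
    intro x t hx ht
    rw [max_eq_left hx, max_eq_left (by linarith), add_sub_cancel]
  refine ⟨_, hz, fun x σ hx hσ => ?_, hw⟩
  have e := h.integral_eq σ (σ + 2 * x) hσ (by linarith)
  rw [goursat_rhs_eq hq hz hw hσ (by linarith), show (σ + 2 * x - σ) / 2 = x by ring] at e
  rw [← e, charVars]
  dsimp only
  rw [max_eq_left hx, max_eq_left hσ, show (σ + 2 * x - σ) / 2 = x by ring,
    show (σ + 2 * x + σ) / 2 = x + σ by ring]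

end Kernel

section Operator

theorem IsVolterraSolution.map {A B : Type*} [NormedRing A] [NormedAlgebra ℝ A] [CompleteSpace A]
    [NormedRing B] [NormedAlgebra ℝ B] [CompleteSpace B] (L : A →L[ℝ] B)
    (hL : ∀ a b, L (a * b) = L a * L b) {q : ℝ → A} (hq : LocallyIntegrable q volume)
    {z : ℝ → ℝ → A} (hz : Continuous z.uncurry) (h : IsVolterraSolution q z) :
    IsVolterraSolution (fun s => L (q s)) (fun x σ => L (z x σ)) := by
  intro x σ hx hσ
  have hcp : ∀ y s, causalPrim (fun x σ => L (z x σ)) y s = L (causalPrim z y s) := fun y s =>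
    L.intervalIntegral_comp_comm
      ((hz.comp (by fun_prop : Continuous fun s => (y, s))).intervalIntegrable _ _)
  have hi := intervalIntegrable_bilin (ContinuousLinearMap.mul ℝ A) hq
    (k := fun y => causalPrim z y (σ - 2 * max (y - x) 0) - causalPrim z y (σ - 2 * y))
    ((continuous_causalPrim_comp hz (by fun_prop) (by fun_prop)).sub
      (continuous_causalPrim_comp hz (by fun_prop) (by fun_prop))) 0 (x + σ / 2)
  simp only [ContinuousLinearMap.mul_apply'] at hi
  simp only [h x σ hx hσ, goursatData, volterra, hcp, ← map_sub, ← hL]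
  rw [L.intervalIntegral_comp_comm hi,
    L.intervalIntegral_comp_comm (hq.intervalIntegrable_real _ _)]
  simp only [map_add, map_neg, map_smul]

/-- The action of matrices on vectors as a continuous map into the algebra of operators. -/
noncomputable def mulVecOperator (n : ℕ) :
    Matrix (Fin n) (Fin n) ℂ →L[ℝ] (Fin n → ℂ) →L[ℝ] (Fin n → ℂ) :=
  LinearMap.toContinuousLinearMap
    { toFun := fun M => LinearMap.toContinuousLinearMap (M.mulVecLin.restrictScalars ℝ)
      map_add' := fun M N => by ext v : 1; simp
      map_smul' := fun c M => by ext v : 1; simp }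

theorem mulVecOperator_apply {n : ℕ} (M : Matrix (Fin n) (Fin n) ℂ) (v : Fin n → ℂ) :
    mulVecOperator n M v = M *ᵥ v := rfl

theorem mulVecOperator_mul {n : ℕ} (M N : Matrix (Fin n) (Fin n) ℂ) :
    mulVecOperator n (M * N) = mulVecOperator n M * mulVecOperator n N := by
  ext v : 1
  simp [mulVecOperator_apply, Matrix.mulVec_mulVec]

end Operator

/-! ### The wave -/

section Wave

variable {n : ℕ} {f : ℝ → Fin n → ℂ}

theorem zeroExt_eventuallyEq_zero (hsupp : closure {t : ℝ | 0 ≤ t ∧ f t ≠ 0} ⊆ Ioi 0) {s : ℝ}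
    (hs : s ≤ 0) : zeroExt f =ᶠ[𝓝 s] 0 := by
  have hmem : (closure {t : ℝ | 0 ≤ t ∧ f t ≠ 0})ᶜ ∈ 𝓝 s :=
    isClosed_closure.isOpen_compl.mem_nhds fun h => absurd (hsupp h) (not_lt.2 hs)
  filter_upwards [hmem] with r hr
  by_cases h0 : r ∈ Ici (0 : ℝ)
  · rw [zeroExt, indicator_of_mem h0]
    by_contra hne
    exact hr (subset_closure ⟨h0, hne⟩)
  · rw [zeroExt, indicator_of_notMem h0, Pi.zero_apply]

theorem contDiff_zeroExt (hf : ContDiffOn ℝ ∞ f (Ici 0))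
    (hsupp : closure {t : ℝ | 0 ≤ t ∧ f t ≠ 0} ⊆ Ioi 0) : ContDiff ℝ ∞ (zeroExt f) := by
  rw [contDiff_iff_contDiffAt]
  intro s
  rcases le_or_gt s 0 with hs | hs
  · exact contDiffAt_const.congr_of_eventuallyEq (zeroExt_eventuallyEq_zero hsupp hs)
  · refine (hf.contDiffAt (Ici_mem_nhds hs)).congr_of_eventuallyEq ?_
    filter_upwards [Ioi_mem_nhds hs] with r hr
    exact indicator_of_mem (show r ∈ Ici (0 : ℝ) from (show 0 < r from hr).le) f

theorem exists_causal_derivatives_zeroExt (hf : ContDiffOn ℝ ∞ f (Ici 0))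
    (hsupp : closure {t : ℝ | 0 ≤ t ∧ f t ≠ 0} ⊆ Ioi 0) :
    ∃ G g₁ g₂ : ℝ → Fin n → ℂ, IsCausal G ∧ IsCausal (zeroExt f) ∧ IsCausal g₁ ∧ IsCausal g₂ ∧
      (∀ s, HasDerivAt G (zeroExt f s) s) ∧ (∀ s, HasDerivAt (zeroExt f) (g₁ s) s) ∧
      (∀ s, HasDerivAt g₁ (g₂ s) s) ∧ Continuous g₂ := by
  have h0 := contDiff_zeroExt hf hsupp
  have h1 : ContDiff ℝ ∞ (deriv (zeroExt f)) := (contDiff_infty_iff_deriv.1 h0).2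
  have h2 : ContDiff ℝ ∞ (deriv (deriv (zeroExt f))) := (contDiff_infty_iff_deriv.1 h1).2
  have hc := h0.continuous
  have z0 : ∀ s ≤ (0 : ℝ), zeroExt f =ᶠ[𝓝 s] fun _ => 0 := fun s hs =>
    zeroExt_eventuallyEq_zero hsupp hs
  have z1 : ∀ s ≤ (0 : ℝ), deriv (zeroExt f) =ᶠ[𝓝 s] fun _ => 0 := fun s hs => by
    simpa using (z0 s hs).deriv
  have z2 : ∀ s ≤ (0 : ℝ), deriv (deriv (zeroExt f)) =ᶠ[𝓝 s] fun _ => 0 := fun s hs => by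
    simpa using (z1 s hs).deriv
  refine ⟨fun σ => ∫ s in (0 : ℝ)..σ, zeroExt f s, deriv (zeroExt f), deriv (deriv (zeroExt f)),
    fun σ hσ => ?_, fun s hs => (z0 s hs).self_of_nhds, fun s hs => (z1 s hs).self_of_nhds,
    fun s hs => (z2 s hs).self_of_nhds, fun s => ?_, fun s => ?_, fun s => ?_, h2.continuous⟩
  · refine intervalIntegral.integral_zero_ae (ae_of_all _ fun s hs => ?_)
    rw [uIoc_of_ge hσ] at hs
    exact (z0 s hs.2).self_of_nhds
  · exact intervalIntegral.integral_hasDerivAt_right (hc.intervalIntegrable _ _)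
      (hc.stronglyMeasurableAtFilter _ _) hc.continuousAt
  · exact (h0.differentiable (by simp)).differentiableAt.hasDerivAt
  · exact (h1.differentiable (by simp)).differentiableAt.hasDerivAt

theorem wave_eq_response (f : ℝ → Fin n → ℂ) (z : ℝ → ℝ → Matrix (Fin n) (Fin n) ℂ)
    (x t : ℝ) :
    wave (fun x t => z x (t - x)) f x t
      = response (fun x σ => mulVecOperator n (z x σ)) (zeroExt f) x (t - x) := by
  have h := intervalIntegral.integral_comp_sub_right (a := x) (b := t)
    (fun s => z x s *ᵥ zeroExt f (t - x - s)) x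
  simp only [sub_sub_sub_cancel_right, sub_self] at h
  rw [wave, h]
  rfl

variable {Q : ℝ → (Fin n → ℂ) →L[ℝ] (Fin n → ℂ)} {Z : ℝ → ℝ → (Fin n → ℂ) →L[ℝ] (Fin n → ℂ)}
  {G g₀ g₁ g₂ : ℝ → Fin n → ℂ}

theorem hasSecondDerivAt_response (hZ : Continuous Z.uncurry) (hg₀ : IsCausal g₀)
    (hg₁ : IsCausal g₁) (hg₂ : IsCausal g₂) (hg₀' : ∀ s, HasDerivAt g₀ (g₁ s) s)
    (hg₁' : ∀ s, HasDerivAt g₁ (g₂ s) s) (hc₂ : Continuous g₂) (x t : ℝ) :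
    HasSecondDerivAt (fun s => response Z g₀ x (s - x)) (response Z g₂ x (t - x)) t :=
  have hc₁ : Continuous g₁ := continuous_iff_continuousAt.2 fun s => (hg₁' s).continuousAt
  ⟨fun s => response Z g₁ x (s - x), Eventually.of_forall fun s =>
      (hg₀.hasDerivAt_response hg₁ hg₀' hc₁ hZ x (s - x)).comp_sub_const s x,
    (hg₁.hasDerivAt_response hg₂ hg₁' hc₂ hZ x (t - x)).comp_sub_const t x⟩

/-- The second space derivative of the wave at time `t`, as the wave equation prescribes it. -/
noncomputable def secondSpaceDeriv (Q : ℝ → (Fin n → ℂ) →L[ℝ] (Fin n → ℂ))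
    (Z : ℝ → ℝ → (Fin n → ℂ) →L[ℝ] (Fin n → ℂ)) (g₀ g₂ : ℝ → Fin n → ℂ) (t x : ℝ) : Fin n → ℂ :=
  response Z g₂ x (t - x) + Q x (response Z g₀ x (t - x))

theorem IsVolterraSolution.exists_hasW21Derivs (h : IsVolterraSolution Q Z)
    (hQ : LocallyIntegrable Q volume) (hZ : Continuous Z.uncurry) (hG : IsCausal G)
    (hg₀ : IsCausal g₀) (hg₁ : IsCausal g₁) (hg₂ : IsCausal g₂)
    (hG' : ∀ s, HasDerivAt G (g₀ s) s) (hg₀' : ∀ s, HasDerivAt g₀ (g₁ s) s)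
    (hg₁' : ∀ s, HasDerivAt g₁ (g₂ s) s) (hc₂ : Continuous g₂) {t : ℝ} (ht : 0 ≤ t) :
    ∃ ux, HasW21Derivs 0 t (fun x => response Z g₀ x (t - x)) ux (secondSpaceDeriv Q Z g₀ g₂ t) ∧
      ∀ᵐ x ∂volume.restrict (Ioo 0 t), HasSecondDerivAt (fun x => response Z g₀ x (t - x))
        (secondSpaceDeriv Q Z g₀ g₂ t x) x := by
  have hc₀ : Continuous g₀ := continuous_iff_continuousAt.2 fun s => (hg₀' s).continuousAt
  have hi : LocallyIntegrable (secondSpaceDeriv Q Z g₀ g₂ t) volume :=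
    locallyIntegrable_of_intervalIntegrable fun a b =>
      ((continuous_response_comp hZ hc₂ continuous_id (by fun_prop)).intervalIntegrable a b).add
        (intervalIntegrable_bilin (ContinuousLinearMap.id ℝ _) hQ
          (continuous_response_comp hZ hc₀ continuous_id (by fun_prop)) a b)
  obtain ⟨c, hc⟩ := h.response_eq_twofold_primitive hQ hZ hG hg₀ hg₁ hg₂ hG' hg₀' hg₁' hc₂ t
  exact ⟨_, hasW21Derivs_of_eq_twofold_primitive ht hi hc⟩

/-- The kernel vanishes at the boundary: for `x = 0` the characteristic rectangle is degenerate. -/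
theorem IsVolterraSolution.zero_left {A : Type*} [NormedRing A] [NormedAlgebra ℝ A] {q : ℝ → A}
    {z : ℝ → ℝ → A} (h : IsVolterraSolution q z) {s : ℝ} (hs : 0 ≤ s) : z 0 s = 0 := by
  have hint : ∫ y in (0 : ℝ)..(0 + s / 2),
      q y * (causalPrim z y (s - 2 * max (y - 0) 0) - causalPrim z y (s - 2 * y)) = 0 := by
    refine intervalIntegral.integral_zero_ae (ae_of_all _ fun y hy => ?_)
    rw [uIoc_of_le (by linarith)] at hy
    rw [sub_zero, max_eq_left hy.1.le, sub_self, mul_zero]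
  rw [h 0 s le_rfl hs, goursatData, volterra, hint, zero_add, intervalIntegral.integral_same]
  simp

theorem IsVolterraSolution.response_zero_left (h : IsVolterraSolution Q Z) {t : ℝ} (ht : 0 ≤ t) :
    response Z g₀ 0 t = g₀ t := by
  rw [response, add_eq_left]
  refine intervalIntegral.integral_zero_ae (ae_of_all _ fun s hs => ?_)
  rw [uIoc_of_le ht] at hs
  rw [h.zero_left hs.1.le, zero_apply]

end Wave

theorem theorem1 (n : ℕ) (q : ℝ → Matrix (Fin n) (Fin n) ℂ)
    (hq : LocallyIntegrableOn q (Ici (0 : ℝ)) volume) :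
    ∃ w : ℝ → ℝ → Matrix (Fin n) (Fin n) ℂ,
      IsGoursatKernel q w ∧
      (∀ w' : ℝ → ℝ → Matrix (Fin n) (Fin n) ℂ, IsGoursatKernel q w' →
        ∀ x t : ℝ, 0 ≤ x → x ≤ t → w' x t = w x t) ∧
      ∀ f : ℝ → Fin n → ℂ, ContDiffOn ℝ ∞ f (Ici 0) →
        closure {t : ℝ | 0 ≤ t ∧ f t ≠ 0} ⊆ Ioi 0 →
        (∀ t : ℝ, 0 < t → ∀ᵐ x ∂volume.restrict (Ioo 0 t),
          ∃ utt uxx : Fin n → ℂ,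
            HasSecondDerivAt (fun s => wave w f x s) utt t ∧
            HasSecondDerivAt (fun y => wave w f y t) uxx x ∧
            utt - uxx + q x *ᵥ wave w f x t = 0) ∧
        (∀ t x : ℝ, 0 ≤ t → t ≤ x → wave w f x t = 0) ∧
        (∀ t : ℝ, 0 ≤ t → wave w f 0 t = f t) ∧
        (∀ t : ℝ, 0 ≤ t → ∃ ux uxx : ℝ → Fin n → ℂ,
          HasW21Derivs 0 t (fun x => wave w f x t) ux uxx ∧
          (∀ᵐ x ∂volume.restrict (Ioo 0 t),
            HasSecondDerivAt (fun y => wave w f y t) (uxx x) x) ∧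
          ∃ g : ℝ → Fin n → ℂ, ContinuousOn g (Icc 0 t) ∧
            ∀ᵐ x ∂volume.restrict (Ioo 0 t), -uxx x + q x *ᵥ wave w f x t = g x) := by
  have hq₀ := locallyIntegrable_indicator_Ici hq
  obtain ⟨z, hz, hsol⟩ := exists_isVolterraSolution hq₀
  refine ⟨fun x t => z x (t - x), hsol.isGoursatKernel hq hz, fun w' hw' x t hx hxt => ?_,
    fun f hf hsupp => ?_⟩
  · obtain ⟨z', hz', hsol', hw⟩ := hw'.exists_isVolterraSolution hq
    rw [hw x t hx hxt]
    exact hsol'.unique hq₀ hz' hz hsol hx (by linarith)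
  obtain ⟨G, g₁, g₂, hG, hg₀, hg₁, hg₂, hG', hg₀', hg₁', hc₂⟩ :=
    exists_causal_derivatives_zeroExt hf hsupp
  set Z : ℝ → ℝ → (Fin n → ℂ) →L[ℝ] (Fin n → ℂ) := fun x σ => mulVecOperator n (z x σ) with hZdef
  set Q : ℝ → (Fin n → ℂ) →L[ℝ] (Fin n → ℂ) :=
    fun s => mulVecOperator n ((Ici 0).indicator q s) with hQdef
  have hZ : Continuous Z.uncurry := (mulVecOperator n).continuous.comp hz
  have hQ : LocallyIntegrable Q volume := locallyIntegrable_of_intervalIntegrable fun a b =>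
    (intervalIntegrable_iff.2
      ((mulVecOperator n).integrable_comp (hq₀.intervalIntegrable_real a b).def'))
  have hsolZ : IsVolterraSolution Q Z := hsol.map (mulVecOperator n) mulVecOperator_mul hq₀ hz
  have hwave : ∀ x t, wave (fun x t => z x (t - x)) f x t = response Z (zeroExt f) x (t - x) :=
    wave_eq_response f z
  simp only [hwave]
  have hQx : ∀ x v, 0 ≤ x → Q x v = q x *ᵥ v := fun x v hx => by
    simp only [hQdef, indicator_of_mem (show x ∈ Ici (0 : ℝ) from hx), mulVecOperator_apply]
  have hspace := fun (t : ℝ) (ht : 0 ≤ t) =>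
    hsolZ.exists_hasW21Derivs hQ hZ hG hg₀ hg₁ hg₂ hG' hg₀' hg₁' hc₂ ht
  refine ⟨fun t ht => ?_, fun t x _ htx => hg₀.response x _ (by linarith), fun t ht => ?_,
    fun t ht => ?_⟩
  · obtain ⟨ux, -, hux⟩ := hspace t ht.le
    filter_upwards [hux, ae_restrict_mem measurableSet_Ioo] with x hx hxt
    refine ⟨_, _, hasSecondDerivAt_response hZ hg₀ hg₁ hg₂ hg₀' hg₁' hc₂ x t, hx, ?_⟩
    rw [secondSpaceDeriv, hQx x _ hxt.1.le]
    abel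
  · rw [sub_zero, hsolZ.response_zero_left ht, zeroExt,
      indicator_of_mem (show t ∈ Ici (0 : ℝ) from ht)]
  · obtain ⟨ux, hW, hux⟩ := hspace t ht
    refine ⟨ux, _, hW, hux, fun x => -response Z g₂ x (t - x),
      (continuous_response_comp hZ hc₂ continuous_id (by fun_prop)).neg.continuousOn, ?_⟩
    filter_upwards [ae_restrict_mem measurableSet_Ioo] with x hxt
    rw [secondSpaceDeriv, hQx x _ hxt.1.le]
    abel
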